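/- All Hilbert spaces are finite-dimensional, and $\log$ is the natural logarithm (with $-\log 0=\infty$). For non-negative operators $\rho\neq 0$ and $\sigma$ and $\alpha\in(0,1)\cup(1,\infty)$ let $$\bar Q_\alpha(\rho\|\sigma)=\operatorname{tr}\rho^\alpha\sigma^{1-\alpha},\qquad \tilde Q_\alpha(\rho\|\sigma)=\operatorname{tr}\bigl(\sigma^{\frac{1-\alpha}{2\alpha}}\rho\,\sigma^{\frac{1-\alpha}{2\alpha}}\bigr)^\alpha ,$$ where negative powers are taken as powers of the generalized inverse. The Petz divergence $\bar D_\alpha$ and the minimal (sandwiched) divergence $\tilde D_\alpha$ are $$D_\alpha(\rho\|\sigma)=\frac1{\alpha-1}\log\Bigl(\frac{1}{\operatorname{tr}\rho}\,Q_\alpha(\rho\|\sigma)\Bigr)\quad\text{if }\ker\sigma\subseteq\ker\rho\text{ or }\alpha<1,\qquad D_\alpha(\rho\|\sigma)=\infty\quad\text{otherwise},$$ with $Q_\alpha=\bar Q_\alpha$ and $Q_\alpha=\tilde Q_\alpha$, respectively, and $D_0=\lim_{\alpha\to0^+}D_\alpha$, $D_1=\lim_{\alpha\to1}D_\alpha$.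 For a density operator $\rho_{AB}$ on $A\otimes B$ with marginal $\rho_B=\operatorname{tr}_A\rho_{AB}$ put $$H^\downarrow_\alpha(A|B)_\rho=-D_\alpha(\rho_{AB}\|\mathbb 1_A\otimes\rho_B),\qquad H^\uparrow_\alpha(A|B)_\rho=\sup_{\sigma_B}\,-D_\alpha(\rho_{AB}\|\mathbb 1_A\otimes\sigma_B),$$ the supremum being over all density operators $\sigma_B$ on $B$ (for $\alpha\in\{0,1\}$ the limit is taken inside the supremum); write $\bar H$ for the entropies built from $\bar D$ and $\tilde H$ for those built from $\tilde D$. **Corollary.** Let $\rho_{AB}$ be a density operator on $A\otimes B$. The limits defining $\bar D_0,\bar D_1,\tilde D_0,\tilde D_1$ at $(\rho_{AB},\mathbb 1_A\otimes\sigma_B)$ exist in $[-\infty,\infty]$ for every density operator $\sigma_B$ on $B$, and for every $\alpha\in[0,1]$ $$\bar H^{\downarrow}_{\alpha}(A|B)_{\rho} \leq \tilde H^{\downarrow}_{\alpha}(A|B)_{\rho}\leq \alpha\, \bar H^{\downarrow}_{\alpha}(A|B)_{\rho}+(1-\alpha)\log |A|,$$ $$\bar H^{\uparrow}_{\alpha}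 (A|B)_{\rho}\leq \tilde H^{\uparrow}_{\alpha}(A|B)_{\rho}\leq \alpha\, \bar H^{\uparrow}_{\alpha}(A|B)_{\rho}+(1-\alpha)\log |A| ,$$ where $|A|$ is the dimension of $A$. -/

import Mathlib

open Filter Topology
open scoped Kronecker ComplexOrder

noncomputable section

namespace QuantumRenyi

/-- A density operator: a positive semidefinite matrix of trace one. -/
def IsDensity {n : Type*} [Fintype n] (ρ : Matrix n n ℂ) : Prop :=
  ρ.PosSemidef ∧ ρ.trace = 1

/-- Real powers of a Hermitian matrix by the functional calculus. As `(0 : ℝ) ^ s = 0` for `s ≠ 0`,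
the kernel is left alone: negative powers of positive semidefinite matrices are powers of the
generalized inverse. Only `s ≠ 0` is used below. -/
def mpow {n : Type*} [Fintype n] [DecidableEq n] (M : Matrix n n ℂ) (s : ℝ) : Matrix n n ℂ :=
  cfc (fun x : ℝ => x ^ s) M

/-- `tr ρ^α σ^(1-α)`. -/
def petzQ {n : Type*} [Fintype n] [DecidableEq n] (α : ℝ) (ρ σ : Matrix n n ℂ) : ℝ :=
  (Matrix.trace (mpow ρ α * mpow σ (1 - α))).re

/-- `tr (σ^((1-α)/(2α)) ρ σ^((1-α)/(2α)))^α`. -/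
def minimalQ {n : Type*} [Fintype n] [DecidableEq n] (α : ℝ) (ρ σ : Matrix n n ℂ) : ℝ :=
  (Matrix.trace (mpow
    (mpow σ ((1 - α) / (2 * α)) * ρ * mpow σ ((1 - α) / (2 * α))) α)).re

/-- `σ ≫ ρ`: the kernel of `σ` is contained in the kernel of `ρ`. -/
def Dominates {n : Type*} [Fintype n] (σ ρ : Matrix n n ℂ) : Prop :=
  LinearMap.ker σ.mulVecLin ≤ LinearMap.ker ρ.mulVecLin

open Classical in
/-- The divergence of order `α ∈ (0,1) ∪ (1,∞)` obtained from the trace functional value `Q`: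
`(α - 1)⁻¹ log (Q / tr ρ)` if `σ ≫ ρ` or `α < 1`, and `∞` otherwise. `ENNReal.log` is the natural
logarithm with `log 0 = -∞`. -/
def divergenceOfQ {n : Type*} [Fintype n] (Q α : ℝ) (ρ σ : Matrix n n ℂ) : EReal :=
  if Dominates σ ρ ∨ α < 1 then
    ((1 / (α - 1) : ℝ) : EReal) * ENNReal.log (ENNReal.ofReal (1 / ρ.trace.re * Q))
  else ⊤

open Classical in
/-- The Petz Rényi divergence; the orders `0` and `1` are defined by limits. -/
def petzDivergence {n : Type*} [Fintype n] [DecidableEq n] (α : ℝ) (ρ σ : Matrix n n ℂ) : EReal :=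
  if α = 0 then limUnder (𝓝[>] (0 : ℝ)) fun a => divergenceOfQ (petzQ a ρ σ) a ρ σ
  else if α = 1 then limUnder (𝓝[≠] (1 : ℝ)) fun a => divergenceOfQ (petzQ a ρ σ) a ρ σ
  else divergenceOfQ (petzQ α ρ σ) α ρ σ

open Classical in
/-- The minimal (sandwiched) Rényi divergence; the orders `0` and `1` are defined by limits. -/
def minimalDivergence {n : Type*} [Fintype n] [DecidableEq n] (α : ℝ) (ρ σ : Matrix n n ℂ) :
    EReal :=
  if α = 0 then limUnder (𝓝[>] (0 : ℝ)) fun a => divergenceOfQ (minimalQ a ρ σ) a ρ σ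
  else if α = 1 then limUnder (𝓝[≠] (1 : ℝ)) fun a => divergenceOfQ (minimalQ a ρ σ) a ρ σ
  else divergenceOfQ (minimalQ α ρ σ) α ρ σ

/-- The partial trace over the first tensor factor, `ρ_B = tr_A ρ_AB`. -/
def traceA {A B : Type*} [Fintype A] (ρ : Matrix (A × B) (A × B) ℂ) : Matrix B B ℂ :=
  Matrix.of fun j j' => ∑ i, ρ (i, j) (i, j')

/-- `1_A ⊗ σ_B`. -/
def idTensor (A : Type*) {B : Type*} [DecidableEq A] (σ : Matrix B B ℂ) :
    Matrix (A × B) (A × B) ℂ :=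
  (1 : Matrix A A ℂ) ⊗ₖ σ

section Entropies

variable {A B : Type*} [Fintype A] [DecidableEq A] [Fintype B] [DecidableEq B]

/-- The Petz conditional entropy `H↓_α(A|B)_ρ`. -/
def petzDown (α : ℝ) (ρ : Matrix (A × B) (A × B) ℂ) : EReal :=
  -petzDivergence α ρ (idTensor A (traceA ρ))

/-- The minimal conditional entropy `H↓_α(A|B)_ρ`. -/
def minimalDown (α : ℝ) (ρ : Matrix (A × B) (A × B) ℂ) : EReal :=
  -minimalDivergence α ρ (idTensor A (traceA ρ))

/-- The Petz conditional entropy `H↑_α(A|B)_ρ`. -/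
def petzUp (α : ℝ) (ρ : Matrix (A × B) (A × B) ℂ) : EReal :=
  ⨆ σ : {σ : Matrix B B ℂ // IsDensity σ}, -petzDivergence α ρ (idTensor A σ.1)

/-- The minimal conditional entropy `H↑_α(A|B)_ρ`. -/
def minimalUp (α : ℝ) (ρ : Matrix (A × B) (A × B) ℂ) : EReal :=
  ⨆ σ : {σ : Matrix B B ℂ // IsDensity σ}, -minimalDivergence α ρ (idTensor A σ.1)

end Entropies

end QuantumRenyi

end

/-! For `σ = 1 ⊗ σ_B`, whose trace is `|A|`, everything reduces to a bound for each fixed `σ`: `-D ≤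
-D̃ ≤ α(-D) + (1-α) log tr σ`, with `D` the Petz and `D̃` the minimal divergence. The suprema follow
because the same `σ` serves on both sides.

For `0 < α < 1` the left bound is the Araki–Lieb–Thirring inequality (`petzQ_le_minimalQ`). The
right bound is its reverse (`minimalQ_le_rpow_petzQ`): split surplus powers of `ρ` and `σ` off the
sandwiched product, apply Hölder twice, and use `tr ρ = 1`.

Both rest on products of the `k` largest squared singular values. These are maximal Gram
determinants, so Cauchy–Binet takes the place of antisymmetric tensor powers and yields the
inequalities of Horn (`kyFan_mul_le`) and Weyl (`prod_eig_sq_le`). Log-majorization then gives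
Hölder for Schatten sums of any positive exponent. Weyl and Horn make `s ↦ kyFan k (A^s B^s)`
midpoint log-convex, which is the core of Araki–Lieb–Thirring.

At the endpoints, the Petz limits come from an explicit double sum over eigenvalues. The minimal
limit at `0` comes from a monotone comparison function, and at `1` from squeezing between Petz
divergences, so that both divergences agree there. -/

noncomputable section

namespace QuantumRenyi

open Matrix Finset

/-! ### Determinants of compressions and ordered eigenvalues -/

section Determinants

variable {n : Type*} [Fintype n] [DecidableEq n] {k : ℕ}

omit [DecidableEq n] in
/-- A symmetrized form of the Cauchy–Binet formula. -/
theorem factorial_mul_det_mul {R : Type*} [CommRing R] (A : Matrix (Fin k) n R)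
    (B : Matrix n (Fin k) R) :
    (k.factorial : R) * (A * B).det
      = ∑ f : Fin k → n, (A.submatrix id f).det * (B.submatrix f id).det := by
  have h1 : (A * B).det = ∑ f : Fin k → n, (∏ i, A i (f i)) * (B.submatrix f id).det := by
    rw [← det_transpose, det_apply']
    simp only [transpose_apply, mul_apply, prod_univ_sum, mul_sum, Fintype.piFinset_univ]
    rw [sum_comm]
    refine sum_congr rfl fun f _ => ?_
    rw [← det_transpose (B.submatrix f id), det_apply', mul_sum]
    refine sum_congr rfl fun σ _ => ?_
    simp only [transpose_apply, submatrix_apply, id, prod_mul_distrib]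
    ring
  -- Reindexing `f` by `τ` permutes the rows of the minor of `B` and produces a sign. Averaging over
  -- `τ` then assembles the products of entries of `A` into a minor.
  have h2 : ∀ τ : Equiv.Perm (Fin k), (A * B).det
      = ∑ f : Fin k → n, (Equiv.Perm.sign τ : R) * (∏ i, A i (f (τ i))) *
          (B.submatrix f id).det := by
    intro τ
    rw [h1, ← (Equiv.arrowCongr τ (Equiv.refl n)).symm.sum_comp]
    refine sum_congr rfl fun f _ => ?_
    have : B.submatrix ((Equiv.arrowCongr τ (Equiv.refl n)).symm f) id
        = (B.submatrix f id).submatrix τ id := by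
      ext; simp [Equiv.arrowCongr]
    rw [this, det_permute]
    simp [Equiv.arrowCongr]
    ring
  calc (k.factorial : R) * (A * B).det = ∑ τ : Equiv.Perm (Fin k), (A * B).det := by
        simp [Fintype.card_perm]
    _ = ∑ f : Fin k → n, ∑ τ : Equiv.Perm (Fin k), (Equiv.Perm.sign τ : R) *
          (∏ i, A i (f (τ i))) * (B.submatrix f id).det := by
        rw [sum_comm]; exact sum_congr rfl fun τ _ => h2 τ
    _ = _ := by
        refine sum_congr rfl fun f _ => ?_
        rw [← sum_mul, ← det_transpose (A.submatrix id f), det_apply' (A.submatrix id f)ᵀ]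
        simp only [transpose_apply, submatrix_apply, id]

/-- List the image of `f` in increasing order: its `m`-th element is at least `m`, so the factors
can be compared one by one. -/
theorem prod_le_prod_range_of_antitone {a : ℕ → ℝ} (ha : Antitone a) (h0 : ∀ i, 0 ≤ a i)
    {f : Fin k → ℕ} (hf : Function.Injective f) : ∏ j, a (f j) ≤ ∏ i ∈ range k, a i := by
  have hc : (univ.image f).card = k := by rw [card_image_of_injective _ hf]; simp
  rw [← prod_image (s := univ) (g := f) (f := a) (fun _ _ _ _ h => hf h),
    ← image_orderEmbOfFin_univ (univ.image f) hc,
    prod_image (fun _ _ _ _ h => (orderEmbOfFin _ hc).injective h), ← Fin.prod_univ_eq_prod_range]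
  refine prod_le_prod (fun _ _ => h0 _) fun i _ => ha ?_
  have : ∀ (m : ℕ) (hm : m < k), m ≤ orderEmbOfFin _ hc ⟨m, hm⟩ := by
    intro m
    induction m with
    | zero => intro _; exact Nat.zero_le _
    | succ m ih =>
      intro hm
      have h := (orderEmbOfFin _ hc).strictMono (a := ⟨m, by omega⟩) (b := ⟨m + 1, hm⟩) (by simp)
      have := ih (by omega)
      omega
  exact this i i.2

end Determinants

section Eigenvalues

variable {n : Type*} [Fintype n] [DecidableEq n] {k : ℕ}

/-- The decreasing sequence of eigenvalues of a Hermitian matrix, continued by `0`. -/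
def eig {H : Matrix n n ℂ} (hH : H.IsHermitian) (i : ℕ) : ℝ :=
  if h : i < Fintype.card n then hH.eigenvalues₀ ⟨i, h⟩ else 0

/-- The position of an index in the decreasing order of the eigenvalues. -/
def rankIdx (i : n) : ℕ := (Fintype.equivOfCardEq (Fintype.card_fin _) : Fin (Fintype.card n) ≃ n).symm i

omit [DecidableEq n] in
theorem rankIdx_injective : Function.Injective (rankIdx : n → ℕ) := fun i j h => by
  simpa [rankIdx, Fin.val_inj] using h

theorem eig_rankIdx {H : Matrix n n ℂ} (hH : H.IsHermitian) (i : n) :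
    eig hH (rankIdx i) = hH.eigenvalues i := by
  simp [eig, rankIdx, IsHermitian.eigenvalues]

theorem eig_nonneg {H : Matrix n n ℂ} (hH : H.PosSemidef) (i : ℕ) : 0 ≤ eig hH.1 i := by
  unfold eig
  split_ifs with h
  · have := hH.eigenvalues_nonneg (Fintype.equivOfCardEq (Fintype.card_fin _) ⟨i, h⟩)
    simpa [IsHermitian.eigenvalues] using this
  · exact le_rfl

theorem eig_antitone {H : Matrix n n ℂ} (hH : H.PosSemidef) : Antitone (eig hH.1) := by
  intro i j hij
  by_cases hj : j < Fintype.card n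
  · have hi := hij.trans_lt hj
    simp only [eig, hi, hj, dif_pos]
    exact hH.1.eigenvalues₀_antitone (by simpa using hij)
  · rw [eig, dif_neg hj]; exact eig_nonneg hH i

theorem eig_of_card_le {H : Matrix n n ℂ} (hH : H.IsHermitian) {i : ℕ} (h : Fintype.card n ≤ i) :
    eig hH i = 0 := dif_neg h.not_gt

theorem sum_eig {H : Matrix n n ℂ} (hH : H.IsHermitian) (f : ℝ → ℝ) :
    ∑ i ∈ range (Fintype.card n), f (eig hH i) = ∑ i, f (hH.eigenvalues i) := by
  rw [← Fin.sum_univ_eq_sum_range (fun i => f (eig hH i)),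
    ← (Fintype.equivOfCardEq (Fintype.card_fin _) : Fin (Fintype.card n) ≃ n).sum_comp]
  refine sum_congr rfl fun i _ => ?_
  simp [eig, IsHermitian.eigenvalues]

theorem trace_cfc {H : Matrix n n ℂ} (hH : H.IsHermitian) (f : ℝ → ℝ) :
    (cfc f H).trace = ((∑ i, f (hH.eigenvalues i) : ℝ) : ℂ) := by
  rw [hH.cfc_eq, IsHermitian.cfc, Unitary.conjStarAlgAut_apply, trace_mul_cycle]
  simp [trace_diagonal]

theorem exists_diagonalization {H : Matrix n n ℂ} (hH : H.IsHermitian) :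
    ∃ U : Matrix n n ℂ, U = hH.eigenvectorUnitary.1 ∧ Uᴴ * U = 1 ∧ U * Uᴴ = 1 ∧
      H = U * diagonal (fun i => (hH.eigenvalues i : ℂ)) * Uᴴ := by
  refine ⟨_, rfl, Unitary.star_mul_self_of_mem hH.eigenvectorUnitary.2,
    Unitary.mul_star_self_of_mem hH.eigenvectorUnitary.2, ?_⟩
  conv_lhs => rw [hH.spectral_theorem, Unitary.conjStarAlgAut_apply]
  rfl

/-- The Ky Fan type bound for determinants of compressions. -/
theorem det_compression_le {H : Matrix n n ℂ} (hH : H.PosSemidef) (Z : Matrix n (Fin k) ℂ) :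
    (Zᴴ * H * Z).det.re ≤ (∏ i ∈ range k, eig hH.1 i) * (Zᴴ * Z).det.re := by
  obtain ⟨U, hU, -, hUU, hsp⟩ := exists_diagonalization hH.1
  set Y := Uᴴ * Z with hY
  have e1 : Zᴴ * H * Z = (Yᴴ * diagonal (fun i => (hH.1.eigenvalues i : ℂ))) * Y := by
    rw [hY, conjTranspose_mul, conjTranspose_conjTranspose]
    conv_lhs => rw [hsp]
    simp only [Matrix.mul_assoc]
  have e2 : Zᴴ * Z = Yᴴ * Y := by
    rw [hY, conjTranspose_mul, conjTranspose_conjTranspose, Matrix.mul_assoc,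
      ← Matrix.mul_assoc U, hUU, Matrix.one_mul]
  have key : ∀ f : Fin k → n, ((Yᴴ).submatrix id f).det * (Y.submatrix f id).det
      = (Complex.normSq (Y.submatrix f id).det : ℂ) := by
    intro f
    have : (Yᴴ).submatrix id f = (Y.submatrix f id)ᴴ := rfl
    rw [this, det_conjTranspose, Complex.normSq_eq_conj_mul_self]; rfl
  have f1 := factorial_mul_det_mul (Yᴴ * diagonal (fun i => (hH.1.eigenvalues i : ℂ))) Y
  have f2 := factorial_mul_det_mul (Yᴴ) Y
  have g : ∀ f : Fin k → n, ((Yᴴ * diagonal (fun i => (hH.1.eigenvalues i : ℂ))).submatrix id f).det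
      * (Y.submatrix f id).det =
      ((∏ j, hH.1.eigenvalues (f j)) * Complex.normSq (Y.submatrix f id).det : ℝ) := by
    intro f
    have : (Yᴴ * diagonal (fun i => (hH.1.eigenvalues i : ℂ))).submatrix id f
        = (Yᴴ).submatrix id f * diagonal (fun j => (hH.1.eigenvalues (f j) : ℂ)) := by
      ext; simp [mul_diagonal]
    rw [this, det_mul, det_diagonal, mul_right_comm, key]
    push_cast; ring
  simp only [g, ← Complex.ofReal_sum] at f1
  simp only [key, ← Complex.ofReal_sum] at f2
  have f1' := congrArg Complex.re f1
  have f2' := congrArg Complex.re f2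
  rw [← Complex.ofReal_natCast, Complex.re_ofReal_mul, Complex.ofReal_re] at f1' f2'
  have hk : (0 : ℝ) < k.factorial := by positivity
  rw [e1, e2]
  refine le_of_mul_le_mul_left ?_ hk
  rw [f1', mul_left_comm, f2', mul_sum]
  refine sum_le_sum fun f _ => ?_
  -- Injective `f` picks distinct eigenvalues, whose product is at most that of the top `k`;
  -- otherwise a repeated row kills the minor.
  by_cases hf : Function.Injective f
  · refine mul_le_mul_of_nonneg_right ?_ (Complex.normSq_nonneg _)
    have := prod_le_prod_range_of_antitone (eig_antitone hH) (eig_nonneg hH)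
      (rankIdx_injective.comp hf)
    simpa [eig_rankIdx] using this
  · have : (Y.submatrix f id).det = 0 := by
      simp only [Function.Injective, not_forall] at hf
      obtain ⟨i, j, h, hij⟩ := hf
      exact det_zero_of_row_eq hij (by ext; simp [h])
    simp [this]

theorem det_gram_nonneg {m : Type*} [Fintype m] (Z : Matrix m (Fin k) ℂ) : 0 ≤ (Zᴴ * Z).det.re :=
  (Complex.le_def.1 (posSemidef_conjTranspose_mul_self Z).det_nonneg).1

/-- The leading eigenvectors of a Hermitian matrix. -/
theorem exists_top_eigenvectors {H : Matrix n n ℂ} (hH : H.IsHermitian)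
    (hk : k ≤ Fintype.card n) : ∃ V : Matrix n (Fin k) ℂ, Vᴴ * V = 1 ∧
      H * V = V * diagonal (fun i : Fin k => (eig hH i : ℂ)) := by
  obtain ⟨U, hU, hUU, -, hsp⟩ := exists_diagonalization hH
  have hHU : H * U = U * diagonal (fun i => (hH.eigenvalues i : ℂ)) := by
    conv_lhs => rw [hsp]
    rw [Matrix.mul_assoc, hUU, Matrix.mul_one]
  let e : Fin k → n := fun i => Fintype.equivOfCardEq (Fintype.card_fin _) (Fin.castLE hk i)
  have he : Function.Injective e := fun i j h => by simpa [e] using h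
  refine ⟨U.submatrix id e, ?_, ?_⟩
  · have : (U.submatrix id e)ᴴ * U.submatrix id e = (Uᴴ * U).submatrix e e := by
      ext; simp [mul_apply]
    rw [this, hUU, submatrix_one _ he]
  · have : H * U.submatrix id e = (H * U).submatrix id e := by ext; simp [mul_apply]
    rw [this, hHU]
    ext i j
    have h2 : hH.eigenvalues (e j) = eig hH j := by
      have : (j : ℕ) < Fintype.card n := j.2.trans_le hk
      simp only [e, IsHermitian.eigenvalues, eig, this, dif_pos, Equiv.symm_apply_apply]
      rfl
    simp [mul_diagonal, h2]

end Eigenvalues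

/-! ### Singular values: inequalities of Horn, Weyl and Hölder -/

section

variable {n : Type*} [Fintype n] [DecidableEq n] {k : ℕ}

/-- The decreasing sequence of squared singular values of a matrix, continued by `0`. -/
def sqSing (X : Matrix n n ℂ) : ℕ → ℝ := eig (isHermitian_conjTranspose_mul_self X)

theorem sqSing_nonneg (X : Matrix n n ℂ) (i : ℕ) : 0 ≤ sqSing X i :=
  eig_nonneg (posSemidef_conjTranspose_mul_self X) i

theorem sqSing_antitone (X : Matrix n n ℂ) : Antitone (sqSing X) :=
  eig_antitone (posSemidef_conjTranspose_mul_self X)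

/-- The product of the `k` largest squared singular values. -/
def kyFan (k : ℕ) (X : Matrix n n ℂ) : ℝ := ∏ i ∈ range k, sqSing X i

theorem kyFan_nonneg (X : Matrix n n ℂ) : 0 ≤ kyFan k X := prod_nonneg fun i _ => sqSing_nonneg X i

theorem kyFan_of_card_lt (X : Matrix n n ℂ) (hk : Fintype.card n < k) : kyFan k X = 0 :=
  prod_eq_zero (mem_range.2 hk) (eig_of_card_le _ le_rfl)

/-- Together with `exists_det_gram_eq` this characterizes `kyFan` variationally; later bounds on
`kyFan` of a product go through these two facts. -/
theorem det_gram_mul_le (X : Matrix n n ℂ) (Z : Matrix n (Fin k) ℂ) :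
    ((X * Z)ᴴ * (X * Z)).det.re ≤ kyFan k X * (Zᴴ * Z).det.re := by
  have := det_compression_le (posSemidef_conjTranspose_mul_self X) Z
  simp only [conjTranspose_mul, Matrix.mul_assoc] at this ⊢
  exact this

theorem exists_det_gram_eq (X : Matrix n n ℂ) (hk : k ≤ Fintype.card n) :
    ∃ V : Matrix n (Fin k) ℂ, Vᴴ * V = 1 ∧ ((X * V)ᴴ * (X * V)).det.re = kyFan k X := by
  obtain ⟨V, hV, h⟩ := exists_top_eigenvectors (isHermitian_conjTranspose_mul_self X) hk
  refine ⟨V, hV, ?_⟩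
  rw [conjTranspose_mul, Matrix.mul_assoc, ← Matrix.mul_assoc Xᴴ, h, ← Matrix.mul_assoc, hV,
    Matrix.one_mul, det_diagonal, kyFan, ← Fin.prod_univ_eq_prod_range, ← Complex.ofReal_prod]
  rfl

/-- Horn's inequality. -/
theorem kyFan_mul_le (X Y : Matrix n n ℂ) : kyFan k (X * Y) ≤ kyFan k X * kyFan k Y := by
  by_cases hk : k ≤ Fintype.card n
  · obtain ⟨V, hV, h⟩ := exists_det_gram_eq (X * Y) hk
    rw [← h, Matrix.mul_assoc]
    refine (det_gram_mul_le X (Y * V)).trans (mul_le_mul_of_nonneg_left ?_ (kyFan_nonneg X))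
    simpa [hV] using det_gram_mul_le Y V
  · rw [kyFan_of_card_lt _ (not_le.1 hk), kyFan_of_card_lt _ (not_le.1 hk), zero_mul]

/-- Weyl's inequality for a product with nonnegative spectrum. -/
theorem prod_eig_sq_le {H : Matrix n n ℂ} (hH : H.PosSemidef) {X Y : Matrix n n ℂ}
    (h : X * Y = H) : (∏ i ∈ range k, eig hH.1 i) ^ 2 ≤ kyFan k (Y * X) := by
  by_cases hk : k ≤ Fintype.card n
  · obtain ⟨V, hV, hHV⟩ := exists_top_eigenvectors hH.1 hk
    set D : Matrix (Fin k) (Fin k) ℂ := diagonal (fun i : Fin k => (eig hH.1 i : ℂ)) with hD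
    have hDH : Dᴴ = D := by
      rw [hD, diagonal_conjTranspose]; congr 1; ext; simp
    have hdet : D.det = ((∏ i ∈ range k, eig hH.1 i : ℝ) : ℂ) := by
      rw [hD, det_diagonal, ← Fin.prod_univ_eq_prod_range, ← Complex.ofReal_prod]
    set p := ∏ i ∈ range k, eig hH.1 i with hp
    have hXZ : X * (Y * V) = V * D := by rw [← Matrix.mul_assoc, h, hHV]
    have h1 := det_gram_mul_le X (Y * V)
    have h2 := det_gram_mul_le (Y * X) (Y * V)
    -- The columns of `Y * V` span a subspace invariant under `Y * X`, on which it acts with the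
    -- same eigenvalues `D`.
    have e2 : (Y * X) * (Y * V) = (Y * V) * D := by
      rw [Matrix.mul_assoc, hXZ, Matrix.mul_assoc]
    have e3 : ∀ W : Matrix n (Fin k) ℂ, ((W * D)ᴴ * (W * D)).det.re = p ^ 2 * (Wᴴ * W).det.re := by
      intro W
      rw [conjTranspose_mul, hDH, Matrix.mul_assoc, ← Matrix.mul_assoc Wᴴ, det_mul, det_mul, hdet,
        Complex.re_ofReal_mul, mul_comm (det _), Complex.re_ofReal_mul]
      ring
    rw [hXZ, e3, hV] at h1
    rw [e2, e3] at h2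
    simp only [det_one, Complex.one_re, mul_one] at h1
    -- If the Gram determinant of `Y * V` vanishes, `h1` forces `p = 0`; otherwise it cancels in
    -- `h2`.
    rcases (det_gram_nonneg (Y * V)).eq_or_lt with h0 | h0
    · rw [← h0, mul_zero] at h1
      exact h1.trans (kyFan_nonneg _)
    · exact le_of_mul_le_mul_right h2 h0
  · have : ∏ i ∈ range k, eig hH.1 i = 0 :=
      prod_eq_zero (mem_range.2 (not_le.1 hk)) (eig_of_card_le _ le_rfl)
    rw [this, zero_pow two_ne_zero]
    exact kyFan_nonneg _

theorem kyFan_one_le : kyFan k (1 : Matrix n n ℂ) ≤ 1 := by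
  by_cases hk : k ≤ Fintype.card n
  · obtain ⟨V, hV, h⟩ := exists_det_gram_eq (1 : Matrix n n ℂ) hk
    rw [← h]; simp [hV]
  · rw [kyFan_of_card_lt _ (not_le.1 hk)]; exact zero_le_one

theorem eig_congr {H K : Matrix n n ℂ} (hH : H.IsHermitian) (hK : K.IsHermitian)
    (h : H.charpoly = K.charpoly) : eig hH = eig hK := by
  have h2 := (hH.eigenvalues_eq_eigenvalues_iff hK).2 h
  funext i
  unfold eig
  split_ifs with hi
  · have := congrFun h2 (Fintype.equivOfCardEq (Fintype.card_fin _) ⟨i, hi⟩)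
    simpa [IsHermitian.eigenvalues] using this
  · rfl

theorem sqSing_conjTranspose (X : Matrix n n ℂ) : sqSing Xᴴ = sqSing X :=
  eig_congr _ _ (by rw [conjTranspose_conjTranspose, charpoly_mul_comm])

/-- Abel summation, run as an induction: lowering the weight on a nonnegative partial sum only
decreases it. -/
theorem sum_mul_nonneg_of_antitone {x s : ℕ → ℝ} (hx : Antitone x) (h0 : ∀ i, 0 ≤ x i)
    (m : ℕ) (hs : ∀ k ≤ m, 0 ≤ ∑ i ∈ range k, s i) : 0 ≤ ∑ i ∈ range m, x i * s i := by
  have key : ∀ j ≤ m, x (j - 1) * ∑ i ∈ range j, s i ≤ ∑ i ∈ range j, x i * s i := by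
    intro j
    induction j with
    | zero => simp
    | succ j ih =>
      intro hj
      rw [sum_range_succ, sum_range_succ, Nat.add_sub_cancel, mul_add]
      refine add_le_add ((mul_le_mul_of_nonneg_right (hx (Nat.sub_le j 1)) (hs j (by omega))).trans
        (ih (by omega))) le_rfl
  exact (mul_nonneg (h0 _) (hs m le_rfl)).trans (key m le_rfl)

/-- Weak log-majorization implies weak majorization of powers. -/
theorem sum_rpow_le_of_prod_le {x y : ℕ → ℝ} (hx : Antitone x) (hx0 : ∀ i, 0 ≤ x i)
    (hy0 : ∀ i, 0 ≤ y i) (N : ℕ)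
    (h : ∀ k ≤ N, ∏ i ∈ range k, x i ≤ ∏ i ∈ range k, y i) {p : ℝ} (hp : 0 < p) :
    ∑ i ∈ range N, x i ^ p ≤ ∑ i ∈ range N, y i ^ p := by
  induction N with
  | zero => simp
  | succ N ih =>
    by_cases hN : x N = 0
    · rw [sum_range_succ, sum_range_succ, hN, Real.zero_rpow hp.ne', add_zero]
      exact (ih fun k hk => h k (by omega)).trans
        (le_add_of_nonneg_right (Real.rpow_nonneg (hy0 N) p))
    · have hxpos : ∀ i ≤ N, 0 < x i := fun i hi =>
        ((hx0 N).lt_of_ne' hN).trans_le (hx hi)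
      have hypos : ∀ i ≤ N, 0 < y i := by
        intro i hi
        have h1 : 0 < ∏ i ∈ range (N + 1), y i :=
          (prod_pos fun i hi => hxpos i (by simpa [Nat.lt_succ_iff] using hi)).trans_le
            (h (N + 1) le_rfl)
        exact (hy0 i).lt_of_ne' ((prod_ne_zero_iff.1 h1.ne') i (by simpa [Nat.lt_succ_iff] using hi))
      have key := sum_mul_nonneg_of_antitone (x := fun i => x i ^ p)
        (s := fun i => Real.log (y i) - Real.log (x i))
        (fun i j hij => Real.rpow_le_rpow (hx0 j) (hx hij) hp.le)
        (fun i => Real.rpow_nonneg (hx0 i) p) (N + 1) (fun k hk => by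
          rw [sum_sub_distrib, ← Real.log_prod, ← Real.log_prod, sub_nonneg]
          · exact Real.log_le_log (prod_pos fun i hi => hxpos i (by have := mem_range.1 hi; omega))
              (h k hk)
          · exact fun i hi => (hxpos i (by have := mem_range.1 hi; omega)).ne'
          · exact fun i hi => (hypos i (by have := mem_range.1 hi; omega)).ne')
      -- The tangent bound `1 + u ≤ exp u` at `u = p (log y - log x)`, scaled by `x ^ p`.
      have hle : ∀ i ∈ range (N + 1), p * (x i ^ p * (Real.log (y i) - Real.log (x i)))
          ≤ y i ^ p - x i ^ p := by
        intro i hi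
        have hi : i ≤ N := by have := mem_range.1 hi; omega
        have h1 := Real.add_one_le_exp (p * (Real.log (y i) - Real.log (x i)))
        have h2 : y i ^ p = x i ^ p * Real.exp (p * (Real.log (y i) - Real.log (x i))) := by
          rw [Real.rpow_def_of_pos (hypos i hi), Real.rpow_def_of_pos (hxpos i hi), ← Real.exp_add]
          congr 1; ring
        have h3 := mul_le_mul_of_nonneg_left h1 (Real.rpow_nonneg (hx0 i) p)
        rw [h2]; linarith
      have := sum_le_sum hle
      rw [← mul_sum, sum_sub_distrib] at this
      have := mul_nonneg hp.le key
      linarith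

/-- The sum of the `p`-th powers of the squared singular values, `tr (Xᴴ X)^p`. -/
def schatten (p : ℝ) (X : Matrix n n ℂ) : ℝ := ∑ i ∈ range (Fintype.card n), sqSing X i ^ p

theorem schatten_nonneg (p : ℝ) (X : Matrix n n ℂ) : 0 ≤ schatten p X :=
  sum_nonneg fun i _ => Real.rpow_nonneg (sqSing_nonneg X i) p

theorem schatten_eq_trace (p : ℝ) (X : Matrix n n ℂ) :
    schatten p X = (mpow (Xᴴ * X) p).trace.re := by
  rw [mpow, trace_cfc (isHermitian_conjTranspose_mul_self X), Complex.ofReal_re]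
  exact sum_eig _ (fun x => x ^ p)

theorem schatten_one (X : Matrix n n ℂ) : schatten 1 X = (Xᴴ * X).trace.re := by
  rw [schatten_eq_trace, mpow]
  simp only [Real.rpow_one]
  rw [cfc_id' ℝ (Xᴴ * X) (ha := (isHermitian_conjTranspose_mul_self X).isSelfAdjoint)]

/-- Horn's inequality is a weak log-majorization of `sqSing (X * Y)` by the termwise product, so
powers can be summed and scalar Hölder applies with exponents `q / p` and `r / p`. No lower bound `p
≥ 1` is needed, which matters for `p = α < 1`. -/
theorem schatten_mul_le (X Y : Matrix n n ℂ) {p q r : ℝ} (hp : 0 < p) (hq : 0 < q) (hr : 0 < r)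
    (h : 1 / p = 1 / q + 1 / r) :
    schatten p (X * Y) ≤ schatten q X ^ (p / q) * schatten r Y ^ (p / r) := by
  have h1 : schatten p (X * Y) ≤
      ∑ i ∈ range (Fintype.card n), (sqSing X i * sqSing Y i) ^ p := by
    refine sum_rpow_le_of_prod_le (sqSing_antitone _) (sqSing_nonneg _)
      (fun i => mul_nonneg (sqSing_nonneg _ i) (sqSing_nonneg _ i)) _ (fun k _ => ?_) hp
    rw [prod_mul_distrib]
    exact kyFan_mul_le X Y
  refine h1.trans ?_
  have hpq : (q / p).HolderConjugate (r / p) := by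
    refine ⟨?_, div_pos hq hp, div_pos hr hp⟩
    rw [inv_div, inv_div, inv_one, div_eq_mul_one_div, div_eq_mul_one_div p r, ← mul_add, ← h,
      mul_one_div_cancel hp.ne']
  have h2 := Real.inner_le_Lp_mul_Lq_of_nonneg (range (Fintype.card n)) hpq
    (f := fun i => sqSing X i ^ p) (g := fun i => sqSing Y i ^ p)
    (fun i _ => Real.rpow_nonneg (sqSing_nonneg _ i) p)
    (fun i _ => Real.rpow_nonneg (sqSing_nonneg _ i) p)
  simp only [← Real.mul_rpow (sqSing_nonneg _ _) (sqSing_nonneg _ _),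
    ← Real.rpow_mul (sqSing_nonneg _ _), mul_div_cancel₀ _ hp.ne', one_div_div] at h2
  exact h2

theorem schatten_mul_mul_le (X Y Z : Matrix n n ℂ) {p C D : ℝ} (hp : 0 < p)
    (hX : ∀ i, sqSing X i ≤ C) (hZ : ∀ i, sqSing Z i ≤ D) :
    schatten p (X * Y * Z) ≤ (C * D) ^ p * schatten p Y := by
  have hC : 0 ≤ C := (sqSing_nonneg X 0).trans (hX 0)
  have hD : 0 ≤ D := (sqSing_nonneg Z 0).trans (hZ 0)
  have h1 : schatten p (X * Y * Z) ≤
      ∑ i ∈ range (Fintype.card n), (C * D * sqSing Y i) ^ p := by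
    refine sum_rpow_le_of_prod_le (sqSing_antitone _) (sqSing_nonneg _)
      (fun i => mul_nonneg (mul_nonneg hC hD) (sqSing_nonneg _ i)) _ (fun k _ => ?_) hp
    have h2 : kyFan k (X * Y * Z) ≤ kyFan k X * kyFan k Y * kyFan k Z :=
      (kyFan_mul_le _ _).trans (mul_le_mul_of_nonneg_right (kyFan_mul_le _ _) (kyFan_nonneg _))
    refine h2.trans ?_
    rw [kyFan, kyFan, kyFan, ← prod_mul_distrib, ← prod_mul_distrib]
    refine prod_le_prod (fun i _ => ?_) fun i _ => ?_
    · exact mul_nonneg (mul_nonneg (sqSing_nonneg _ i) (sqSing_nonneg _ i)) (sqSing_nonneg _ i)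
    · rw [mul_right_comm]
      exact mul_le_mul_of_nonneg_right (mul_le_mul (hX i) (hZ i) (sqSing_nonneg _ i) hC)
        (sqSing_nonneg _ i)
  refine h1.trans_eq ?_
  rw [schatten, mul_sum]
  exact sum_congr rfl fun i _ => Real.mul_rpow (mul_nonneg hC hD) (sqSing_nonneg _ i)

end

/-! ### Matrix powers and the Araki–Lieb–Thirring inequality -/

section

variable {n : Type*} [Fintype n] [DecidableEq n] {k : ℕ}

section Powers

variable {M : Matrix n n ℂ}

theorem continuousOn_spectrum (f : ℝ → ℝ) (M : Matrix n n ℂ) : ContinuousOn f (spectrum ℝ M) :=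
  Matrix.finite_real_spectrum.continuousOn f

theorem continuousOn_image_spectrum (f g : ℝ → ℝ) (M : Matrix n n ℂ) :
    ContinuousOn f (g '' spectrum ℝ M) :=
  (Matrix.finite_real_spectrum.image g).continuousOn f

theorem nonneg_of_mem_spectrum (hM : M.PosSemidef) {x : ℝ} (hx : x ∈ spectrum ℝ M) : 0 ≤ x := by
  rw [hM.1.spectrum_real_eq_range_eigenvalues] at hx
  obtain ⟨i, rfl⟩ := hx
  exact hM.eigenvalues_nonneg i

theorem cfc_posSemidef (hM : M.IsHermitian) {f : ℝ → ℝ} (hf : ∀ i, 0 ≤ f (hM.eigenvalues i)) :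
    (cfc f M).PosSemidef := by
  rw [hM.cfc_eq, IsHermitian.cfc, Unitary.conjStarAlgAut_apply]
  refine PosSemidef.mul_mul_conjTranspose_same (PosSemidef.diagonal fun i => ?_) _
  simpa using hf i

theorem mpow_posSemidef (hM : M.PosSemidef) (s : ℝ) : (mpow M s).PosSemidef :=
  cfc_posSemidef hM.1 fun i => Real.rpow_nonneg (hM.eigenvalues_nonneg i) s

theorem conjTranspose_mpow (hM : M.PosSemidef) (s : ℝ) : (mpow M s)ᴴ = mpow M s :=
  (mpow_posSemidef hM s).1

/-- On the kernel both sides vanish exactly because `u ≠ 0`; for `u = 0` and `s ≠ 0` the product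
would be the support projection, not `1`. -/
theorem mpow_mul_mpow (hM : M.PosSemidef) {s t u : ℝ} (h : s + t = u) (hu : u ≠ 0) :
    mpow M s * mpow M t = mpow M u := by
  rw [mpow, mpow, ← cfc_mul _ _ M (continuousOn_spectrum _ M) (continuousOn_spectrum _ M), mpow]
  exact cfc_congr fun x hx => by
    simp only [← h]
    rw [Real.rpow_add' (nonneg_of_mem_spectrum hM hx) (h.trans_ne hu)]

theorem mpow_mpow (hM : M.PosSemidef) (s t : ℝ) : mpow (mpow M s) t = mpow M (s * t) := by
  rw [mpow, mpow, ← cfc_comp' _ _ M (continuousOn_image_spectrum _ _ M)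
    (continuousOn_spectrum _ M) hM.1.isSelfAdjoint, mpow]
  exact cfc_congr fun x hx => (Real.rpow_mul (nonneg_of_mem_spectrum hM hx) s t).symm

theorem mpow_one (hM : M.PosSemidef) : mpow M 1 = M := by
  simp only [mpow, Real.rpow_one]
  exact cfc_id' ℝ M hM.1.isSelfAdjoint

theorem mpow_zero (hM : M.PosSemidef) : mpow M 0 = 1 := by
  simp only [mpow, Real.rpow_zero]
  exact cfc_const_one ℝ M hM.1.isSelfAdjoint

theorem mpow_eq (hM : M.PosSemidef) (s : ℝ) : mpow M s = hM.1.eigenvectorUnitary.1 *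
    diagonal (fun i => ((hM.1.eigenvalues i ^ s : ℝ) : ℂ)) * hM.1.eigenvectorUnitary.1ᴴ := by
  rw [mpow, hM.1.cfc_eq, IsHermitian.cfc, Unitary.conjStarAlgAut_apply]
  rfl

theorem continuousOn_mpow (hM : M.PosSemidef) : ContinuousOn (mpow M) {0}ᶜ := by
  intro s hs
  have : mpow M = fun s => _ := funext (mpow_eq hM)
  rw [this]
  refine ContinuousAt.continuousWithinAt ?_
  refine ContinuousAt.mul (ContinuousAt.mul continuousAt_const ?_) continuousAt_const
  refine continuousAt_pi.2 fun i => continuousAt_pi.2 fun j => ?_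
  by_cases hij : i = j
  · subst hij
    simp only [diagonal_apply_eq]
    exact Complex.continuous_ofReal.continuousAt.comp (Real.continuousAt_const_rpow' hs)
  · simp only [diagonal_apply_ne _ hij]
    exact continuousAt_const

/-- The projection onto the support of a Hermitian matrix. -/
def suppProj (M : Matrix n n ℂ) : Matrix n n ℂ := cfc (fun x : ℝ => if x = 0 then 0 else 1) M

theorem suppProj_posSemidef (hM : M.PosSemidef) : (suppProj M).PosSemidef :=
  cfc_posSemidef hM.1 fun i => by split_ifs <;> norm_num

theorem mpow_suppProj (hM : M.PosSemidef) {s : ℝ} (hs : s ≠ 0) :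
    mpow (suppProj M) s = suppProj M := by
  rw [mpow, suppProj, ← cfc_comp' _ _ M (continuousOn_image_spectrum _ _ M)
    (continuousOn_spectrum _ M) hM.1.isSelfAdjoint]
  exact cfc_congr fun x _ => by split_ifs <;> simp [hs]

theorem mpow_mul_mpow_neg (hM : M.PosSemidef) {s : ℝ} (hs : s ≠ 0) :
    mpow M s * mpow M (-s) = suppProj M := by
  rw [mpow, mpow, ← cfc_mul _ _ M (continuousOn_spectrum _ M) (continuousOn_spectrum _ M), suppProj]
  refine cfc_congr fun x hx => ?_
  split_ifs with h
  · simp [h, hs]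
  · rw [← Real.rpow_add ((nonneg_of_mem_spectrum hM hx).lt_of_ne' h), add_neg_cancel,
      Real.rpow_zero]

theorem mpow_mul_suppProj {s : ℝ} (hs : s ≠ 0) :
    mpow M s * suppProj M = mpow M s := by
  rw [mpow, suppProj, ← cfc_mul _ _ M (continuousOn_spectrum _ M) (continuousOn_spectrum _ M)]
  refine cfc_congr fun x _ => ?_
  split_ifs with h <;> simp [h, hs]

/-- Evaluates the outer factors in Hölder: the exponents are always chosen so that a power of `ρ` or
`σ` contributes only its trace. -/
theorem schatten_mpow (hM : M.PosSemidef) {s p : ℝ} (hs : s ≠ 0) (h : 2 * s * p = 1) :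
    schatten p (mpow M s) = M.trace.re := by
  rw [schatten_eq_trace, conjTranspose_mpow hM, mpow_mul_mpow hM (two_mul s).symm (by simpa),
    mpow_mpow hM, h, mpow_one hM]

end Powers

section ArakiLiebThirring

variable {A B : Matrix n n ℂ}

/-- Write `B^u A^(2u) B^u` as `B^(t-u)` times `B^s A^(s+t) B^u`. Weyl's inequality allows swapping
the two factors, which gives `(A^s B^s)ᴴ (A^t B^t)`, and Horn's inequality splits that. -/
theorem kyFan_midpoint_le (hA : A.PosSemidef) (hB : B.PosSemidef) {s t u : ℝ} (h0 : 0 ≤ s)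
    (ht : 0 < t) (hu : 2 * u = s + t) :
    kyFan k (mpow A u * mpow B u) ^ 2
      ≤ kyFan k (mpow A s * mpow B s) * kyFan k (mpow A t * mpow B t) := by
  have hu0 : u ≠ 0 := by intro h; rw [h] at hu; linarith
  have key := prod_eig_sq_le (k := k)
    (posSemidef_conjTranspose_mul_self (mpow A u * mpow B u))
    (X := mpow B (t - u)) (Y := mpow B s * mpow A (s + t) * mpow B u) (by
      rw [conjTranspose_mul, conjTranspose_mpow hA, conjTranspose_mpow hB]
      simp only [← Matrix.mul_assoc]
      rw [mpow_mul_mpow hB (show t - u + s = u by linarith) hu0, Matrix.mul_assoc (mpow B u) (mpow A u) (mpow A u),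
        mpow_mul_mpow hA (show u + u = s + t by linarith) (by linarith)])
  refine key.trans ?_
  have h1 : mpow B s * mpow A (s + t) * mpow B u * mpow B (t - u)
      = (mpow A s * mpow B s)ᴴ * (mpow A t * mpow B t) := by
    rw [Matrix.mul_assoc _ (mpow B u), mpow_mul_mpow hB (show u + (t - u) = t by ring) ht.ne',
      conjTranspose_mul, conjTranspose_mpow hA, conjTranspose_mpow hB,
      ← mpow_mul_mpow hA (rfl : s + t = s + t) (by linarith)]
    simp only [Matrix.mul_assoc]
  rw [h1]
  refine (kyFan_mul_le _ _).trans_eq ?_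
  rw [kyFan, sqSing_conjTranspose]; rfl

/-- Midpoint log-convexity interpolates between the exponents `0` and `1`: an even numerator
descends to level `j`, an odd one is a midpoint of two neighbours there. -/
theorem kyFan_mpow_le_of_dyadic (hA : A.PosSemidef) (hB : B.PosSemidef) (j : ℕ) :
    ∀ m : ℕ, m ≤ 2 ^ j → kyFan k (mpow A (m / 2 ^ j : ℝ) * mpow B (m / 2 ^ j : ℝ))
      ≤ kyFan k (A * B) ^ (m / 2 ^ j : ℝ) := by
  have hK : 0 ≤ kyFan k (A * B) := kyFan_nonneg _
  induction j with
  | zero =>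
    intro m hm
    have : m = 0 ∨ m = 1 := by omega
    rcases this with rfl | rfl
    · simpa [mpow_zero hA, mpow_zero hB] using kyFan_one_le
    · simp [mpow_one hA, mpow_one hB]
  | succ j ih =>
    intro m hm
    rcases Nat.even_or_odd' m with ⟨i, rfl | rfl⟩
    · have : ((2 * i : ℕ) / 2 ^ (j + 1) : ℝ) = i / 2 ^ j := by
        push_cast; rw [pow_succ]; field_simp
      rw [this]
      exact ih i (by rw [pow_succ] at hm; omega)
    · have hi : i + 1 ≤ 2 ^ j := by rw [pow_succ] at hm; omega
      have h2 : (0 : ℝ) < 2 ^ j := by positivity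
      have h1 := kyFan_midpoint_le (k := k) hA hB (s := i / 2 ^ j) (t := (i + 1 : ℕ) / 2 ^ j)
        (u := (2 * i + 1 : ℕ) / 2 ^ (j + 1)) (by positivity)
        (by positivity) (by push_cast; rw [pow_succ]; field_simp; ring)
      refine le_of_sq_le_sq ?_ (Real.rpow_nonneg hK _)
      refine h1.trans ((mul_le_mul (ih i (by omega)) (ih (i + 1) hi) (kyFan_nonneg _)
        (Real.rpow_nonneg hK _)).trans_eq ?_)
      rw [← Real.rpow_add' hK (by positivity), ← Real.rpow_natCast (_ ^ _), ← Real.rpow_mul hK]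
      congr 1
      push_cast; rw [pow_succ]; field_simp; ring

/-- The log-majorization behind the Araki–Lieb–Thirring inequality. -/
theorem kyFan_mpow_mul_mpow_le (hA : A.PosSemidef) (hB : B.PosSemidef) {r : ℝ} (hr : 0 < r)
    (hr1 : r ≤ 1) : kyFan k (mpow A r * mpow B r) ≤ kyFan k (A * B) ^ r := by
  by_cases hk : k ≤ Fintype.card n
  -- Fixing the maximizer `V` at `r` leaves a determinant that is continuous in the exponent, so the
  -- dyadic bounds pass to the limit without continuity of `kyFan`.
  · obtain ⟨V, hV, h⟩ := exists_det_gram_eq (mpow A r * mpow B r) hk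
    rw [← h]
    have h2 : Tendsto (fun j : ℕ => (2 : ℝ) ^ j) atTop atTop :=
      tendsto_pow_atTop_atTop_of_one_lt one_lt_two
    have hlim : Tendsto (fun j : ℕ => (⌊r * 2 ^ j⌋₊ / 2 ^ j : ℝ)) atTop (𝓝 r) :=
      (tendsto_nat_floor_mul_div_atTop hr.le).comp h2
    have hcont : ContinuousAt (fun s => (((mpow A s * mpow B s) * V)ᴴ *
        ((mpow A s * mpow B s) * V)).det.re) r := by
      have hAc := (continuousOn_mpow hA).continuousAt (isOpen_compl_singleton.mem_nhds hr.ne')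
      have hBc := (continuousOn_mpow hB).continuousAt (isOpen_compl_singleton.mem_nhds hr.ne')
      have hc : Continuous fun P : Matrix n n ℂ × Matrix n n ℂ =>
          (((P.1 * P.2) * V)ᴴ * ((P.1 * P.2) * V)).det.re :=
        Complex.continuous_re.comp (by fun_prop)
      exact ContinuousAt.comp (f := fun s => (mpow A s, mpow B s)) hc.continuousAt
        (hAc.prodMk hBc)
    refine le_of_tendsto_of_tendsto (hcont.tendsto.comp hlim)
      ((Real.continuousAt_const_rpow' (a := kyFan k (A * B)) hr.ne').tendsto.comp hlim)
      (Eventually.of_forall fun j => ?_)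
    have hm : ⌊r * 2 ^ j⌋₊ ≤ 2 ^ j := by
      refine Nat.floor_le_of_le ?_
      push_cast
      exact mul_le_of_le_one_left (by positivity) hr1
    refine (det_gram_mul_le _ V).trans ?_
    rw [hV, det_one, Complex.one_re, mul_one]
    exact kyFan_mpow_le_of_dyadic hA hB j _ hm
  · rw [kyFan_of_card_lt _ (not_le.1 hk)]
    exact Real.rpow_nonneg (kyFan_nonneg _) _

/-- The Araki–Lieb–Thirring inequality. -/
theorem schatten_mpow_mul_mpow_le (hA : A.PosSemidef) (hB : B.PosSemidef) {q r : ℝ} (hq : 0 < q)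
    (hr : 0 < r) (hr1 : r ≤ 1) :
    schatten q (mpow A r * mpow B r) ≤ schatten (r * q) (A * B) := by
  refine (sum_rpow_le_of_prod_le (y := fun i => sqSing (A * B) i ^ r) (sqSing_antitone _)
    (sqSing_nonneg _) (fun i => Real.rpow_nonneg (sqSing_nonneg _ i) r) _
    (fun k _ => ?_) hq).trans_eq ?_
  · rw [Real.finsetProd_rpow _ _ fun i _ => sqSing_nonneg _ i]
    exact kyFan_mpow_mul_mpow_le hA hB hr hr1
  · exact sum_congr rfl fun i _ => (Real.rpow_mul (sqSing_nonneg _ i) r q).symm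

end ArakiLiebThirring

end

/-! ### Inequalities between the trace functionals -/

section

variable {n : Type*} [Fintype n] [DecidableEq n] {ρ σ : Matrix n n ℂ} {α : ℝ}

theorem petzQ_eq_schatten (hρ : ρ.PosSemidef) (hσ : σ.PosSemidef) (h0 : α ≠ 0) (h1 : α ≠ 1) :
    petzQ α ρ σ = schatten 1 (mpow ρ (α / 2) * mpow σ ((1 - α) / 2)) := by
  have h1' : 1 - α ≠ 0 := sub_ne_zero.2 h1.symm
  rw [schatten_one, conjTranspose_mul, conjTranspose_mpow hρ, conjTranspose_mpow hσ, petzQ,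
    Matrix.mul_assoc, ← Matrix.mul_assoc (mpow ρ _), mpow_mul_mpow hρ (add_halves α) h0,
    trace_mul_comm (mpow σ ((1 - α) / 2)), Matrix.mul_assoc, mpow_mul_mpow hσ (add_halves _) h1']

theorem minimalQ_eq_schatten (hρ : ρ.PosSemidef) (hσ : σ.PosSemidef) :
    minimalQ α ρ σ = schatten α (mpow ρ (1 / 2) * mpow σ ((1 - α) / (2 * α))) := by
  rw [schatten_eq_trace, conjTranspose_mul, conjTranspose_mpow hρ, conjTranspose_mpow hσ, minimalQ,
    Matrix.mul_assoc _ (mpow ρ _), ← Matrix.mul_assoc (mpow ρ _),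
    mpow_mul_mpow hρ (add_halves 1) one_ne_zero, mpow_one hρ, Matrix.mul_assoc]

theorem petzQ_nonneg (hρ : ρ.PosSemidef) (hσ : σ.PosSemidef) (h0 : α ≠ 0) (h1 : α ≠ 1) :
    0 ≤ petzQ α ρ σ := by
  rw [petzQ_eq_schatten hρ hσ h0 h1]; exact schatten_nonneg _ _

theorem minimalQ_nonneg (hρ : ρ.PosSemidef) (hσ : σ.PosSemidef) : 0 ≤ minimalQ α ρ σ := by
  rw [minimalQ_eq_schatten hρ hσ]; exact schatten_nonneg _ _

/-- Araki–Lieb–Thirring for `ρ^(1/2)` and `σ^((1-α)/(2α))`, whose `α`-th powers are the Petz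
factors. -/
theorem petzQ_le_minimalQ (hρ : ρ.PosSemidef) (hσ : σ.PosSemidef) (h0 : 0 < α) (h1 : α < 1) :
    petzQ α ρ σ ≤ minimalQ α ρ σ := by
  have := schatten_mpow_mul_mpow_le (mpow_posSemidef hρ (1 / 2))
    (mpow_posSemidef hσ ((1 - α) / (2 * α))) one_pos h0 h1.le
  rw [petzQ_eq_schatten hρ hσ h0.ne' h1.ne, minimalQ_eq_schatten hρ hσ]
  rw [mpow_mpow hρ, mpow_mpow hσ, mul_one] at this
  convert this using 4 <;> field_simp

theorem minimalQ_le_petzQ (hρ : ρ.PosSemidef) (hσ : σ.PosSemidef) (h1 : 1 < α) :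
    minimalQ α ρ σ ≤ petzQ α ρ σ := by
  have h0 : 0 < α := one_pos.trans h1
  have := schatten_mpow_mul_mpow_le (mpow_posSemidef hρ (α / 2))
    (mpow_posSemidef hσ ((1 - α) / 2)) h0 (one_div_pos.2 h0) ((div_le_one h0).2 h1.le)
  rw [petzQ_eq_schatten hρ hσ h0.ne' h1.ne', minimalQ_eq_schatten hρ hσ]
  rw [mpow_mpow hρ, mpow_mpow hσ, one_div_mul_cancel h0.ne'] at this
  convert this using 4 <;> field_simp

/-- Hölder with `1/α = 1 + (1-α)/α`. -/
theorem minimalQ_le_rpow_trace (hρ : ρ.PosSemidef) (hρ1 : ρ.trace.re = 1) (hσ : σ.PosSemidef)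
    (h0 : 0 < α) (h1 : α < 1) : minimalQ α ρ σ ≤ σ.trace.re ^ (1 - α) := by
  have h1' : 0 < 1 - α := sub_pos.2 h1
  rw [minimalQ_eq_schatten hρ hσ]
  refine (schatten_mul_le _ _ (q := 1) (r := α / (1 - α)) h0 one_pos (div_pos h0 h1')
    (by field_simp; ring)).trans_eq ?_
  rw [schatten_mpow hρ (by norm_num) (by norm_num), hρ1, Real.one_rpow, one_mul,
    schatten_mpow hσ (by positivity) (by field_simp)]
  congr 1
  field_simp

/-- The reverse Araki–Lieb–Thirring inequality. -/
theorem minimalQ_le_rpow_petzQ (hρ : ρ.PosSemidef) (hρ1 : ρ.trace.re = 1) (hσ : σ.PosSemidef)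
    (h0 : 0 < α) (h1 : α < 1) :
    minimalQ α ρ σ ≤ petzQ α ρ σ ^ α * σ.trace.re ^ ((1 - α) ^ 2) := by
  have h1' : 0 < 1 - α := sub_pos.2 h1
  -- The Petz product sits in the middle; the outer powers are what remains.
  have e : mpow ρ (1 / 2) * mpow σ ((1 - α) / (2 * α)) =
      mpow ρ ((1 - α) / 2) * ((mpow ρ (α / 2) * mpow σ ((1 - α) / 2)) *
        mpow σ ((1 - α) ^ 2 / (2 * α))) := by
    rw [Matrix.mul_assoc (mpow ρ (α / 2)), ← Matrix.mul_assoc,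
      mpow_mul_mpow hρ (u := 1 / 2) (by ring) (by norm_num),
      mpow_mul_mpow hσ (u := (1 - α) / (2 * α)) (by field_simp; ring) (by positivity)]
  have hs : 0 < 1 + (1 - α) ^ 2 / α := by positivity
  -- The reciprocal Hölder exponents are `1 - α` for `ρ`, `1` for the Petz product and `(1-α)²/α`
  -- for `σ`; they add up to `1/α`.
  rw [minimalQ_eq_schatten hρ hσ, e]
  refine (schatten_mul_le _ _ (q := 1 / (1 - α)) (r := 1 / (1 + (1 - α) ^ 2 / α)) h0
    (by positivity) (by positivity) (by field_simp; ring)).trans ?_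
  rw [schatten_mpow hρ (by positivity) (by field_simp), hρ1, Real.one_rpow, one_mul]
  refine (Real.rpow_le_rpow (schatten_nonneg _ _) (schatten_mul_le _ _ (q := 1)
    (r := α / (1 - α) ^ 2) (by positivity) one_pos (by positivity) (by field_simp))
    (by positivity)).trans_eq ?_
  rw [Real.mul_rpow (Real.rpow_nonneg (schatten_nonneg _ _) _)
    (Real.rpow_nonneg (schatten_nonneg _ _) _), ← Real.rpow_mul (schatten_nonneg _ _),
    ← Real.rpow_mul (schatten_nonneg _ _), schatten_mpow hσ (by positivity) (by field_simp),
    petzQ_eq_schatten hρ hσ h0.ne' h1.ne]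
  congr 2 <;> field_simp

/-- The order `2 - 1/α` is the one whose Petz power of `σ` equals the sandwiching power. The
leftover power of `ρ` is removed by Hölder. This is the lower half of the squeeze from above at
order `1`. -/
theorem petzQ_le_rpow_minimalQ (hρ : ρ.PosSemidef) (hρ1 : ρ.trace.re = 1) (hσ : σ.PosSemidef)
    (h1 : 1 < α) : petzQ (2 - 1 / α) ρ σ ≤ minimalQ α ρ σ ^ (1 / α) := by
  have h0 : 0 < α := one_pos.trans h1
  have h1' : 0 < α - 1 := sub_pos.2 h1
  have h2 : 1 / α < 1 := (div_lt_one h0).2 h1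
  have e : mpow ρ ((2 - 1 / α) / 2) * mpow σ ((1 - (2 - 1 / α)) / 2) =
      mpow ρ ((α - 1) / (2 * α)) * (mpow ρ (1 / 2) * mpow σ ((1 - α) / (2 * α))) := by
    rw [← Matrix.mul_assoc, mpow_mul_mpow hρ (u := (2 - 1 / α) / 2) (by field_simp; ring)
      (by linarith)]
    congr 2
    field_simp; ring
  rw [petzQ_eq_schatten hρ hσ (by linarith) (by linarith), e]
  refine (schatten_mul_le _ _ (q := α / (α - 1)) (r := α) one_pos (by positivity) h0
    (by field_simp; ring)).trans_eq ?_
  rw [schatten_mpow hρ (by positivity) (by field_simp), hρ1, Real.one_rpow, one_mul,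
    minimalQ_eq_schatten hρ hσ]

/-- Strict positivity of `C` is needed for `C ^ a → 1` as `a → 0`. -/
theorem exists_sqSing_le (X : Matrix n n ℂ) : ∃ C > 0, ∀ i, sqSing X i ≤ C :=
  ⟨sqSing X 0 + 1, by linarith [sqSing_nonneg X 0],
    fun i => (sqSing_antitone X (Nat.zero_le i)).trans (by linarith)⟩

/-- Replace `ρ^(1/2)` by its support projection and `σ^((1-a)/(2a))` by `σ^(1/(2a))`. This costs
fixed factors only, hence some `C ^ a → 1`. A projection equals its own powers, so
Araki–Lieb–Thirring makes the new function `G` antitone in `a`; it is bounded, so it converges. -/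
theorem exists_tendsto_minimalQ_zero (hρ : ρ.PosSemidef) (hσ : σ.PosSemidef) :
    ∃ L, Tendsto (fun a => minimalQ a ρ σ) (𝓝[>] 0) (𝓝 L) := by
  set P := suppProj ρ
  have hPp : P.PosSemidef := suppProj_posSemidef hρ
  set G : ℝ → ℝ := fun a => schatten a (P * mpow σ (1 / (2 * a))) with hG
  have hanti : AntitoneOn G (Set.Ioi 0) := by
    intro a ha b hb hab
    have ha : 0 < a := ha
    have hb : 0 < b := hb
    have := schatten_mpow_mul_mpow_le hPp (mpow_posSemidef hσ (1 / (2 * a))) (q := b)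
      (r := a / b) hb (div_pos ha hb) ((div_le_one hb).2 hab)
    rw [mpow_suppProj hρ (div_pos ha hb).ne', mpow_mpow hσ, div_mul_cancel₀ _ hb.ne'] at this
    have e : 1 / (2 * a) * (a / b) = 1 / (2 * b) := by field_simp
    rwa [e] at this
  obtain ⟨c, hc, hcP⟩ := exists_sqSing_le P
  obtain ⟨d, hd, hd1⟩ := exists_sqSing_le (1 : Matrix n n ℂ)
  have hbdd : ∀ a ∈ Set.Ioo (0 : ℝ) 1, G a ≤ max 1 (c * d) * σ.trace.re := by
    intro a ha
    have := schatten_mul_mul_le P (mpow σ (1 / (2 * a))) 1 ha.1 hcP hd1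
    rw [Matrix.mul_one, schatten_mpow hσ (by have := ha.1; positivity)
      (by have := ha.1; field_simp)] at this
    refine this.trans (mul_le_mul_of_nonneg_right ?_ ?_)
    · have hcd : 0 ≤ c * d := by positivity
      rcases le_total (c * d) 1 with h | h
      · exact (Real.rpow_le_one hcd h ha.1.le).trans (le_max_left _ _)
      · exact ((Real.rpow_le_rpow_of_exponent_le h ha.2.le).trans_eq (Real.rpow_one _)).trans
          (le_max_right _ _)
    · exact (Complex.le_def.1 hσ.trace_nonneg).1
  have hGlim : ∃ L, Tendsto G (𝓝[>] 0) (𝓝 L) := by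
    refine ⟨sSup (G '' Set.Ioo 0 1), ?_⟩
    refine (hanti.mono Set.Ioo_subset_Ioi_self).tendsto_nhdsWithin_Ioo_right (Set.nonempty_Ioo.2 one_pos) ?_
    exact ⟨_, by rintro _ ⟨a, ha, rfl⟩; exact hbdd a ha⟩
  obtain ⟨L, hL⟩ := hGlim
  refine ⟨L, ?_⟩
  obtain ⟨c1, hc1, h1⟩ := exists_sqSing_le (mpow ρ (1 / 2))
  obtain ⟨c2, hc2, h2⟩ := exists_sqSing_le (mpow σ (-(1 / 2)))
  obtain ⟨c3, hc3, h3⟩ := exists_sqSing_le (mpow ρ (-(1 / 2)))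
  obtain ⟨c4, hc4, h4⟩ := exists_sqSing_le (mpow σ (1 / 2))
  have hup : ∀ a ∈ Set.Ioo (0 : ℝ) 1, minimalQ a ρ σ ≤ (c1 * c2) ^ a * G a := by
    intro a ha
    have ha1 : 0 < 1 - a := sub_pos.2 ha.2
    have ha0 := ha.1
    have := schatten_mul_mul_le (mpow ρ (1 / 2)) (P * mpow σ (1 / (2 * a))) (mpow σ (-(1 / 2)))
      ha.1 h1 h2
    rw [minimalQ_eq_schatten hρ hσ]
    convert this using 2
    rw [← Matrix.mul_assoc, mpow_mul_suppProj (by norm_num), Matrix.mul_assoc,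
      mpow_mul_mpow hσ (u := (1 - a) / (2 * a)) (by field_simp; ring) (by positivity)]
  have hlow : ∀ a ∈ Set.Ioo (0 : ℝ) 1, G a ≤ (c3 * c4) ^ a * minimalQ a ρ σ := by
    intro a ha
    have ha1 : 0 < 1 - a := sub_pos.2 ha.2
    have ha0 := ha.1
    have := schatten_mul_mul_le (mpow ρ (-(1 / 2)))
      (mpow ρ (1 / 2) * mpow σ ((1 - a) / (2 * a))) (mpow σ (1 / 2)) ha.1 h3 h4
    rw [minimalQ_eq_schatten hρ hσ]
    convert this using 2
    have e : mpow ρ (-(1 / 2)) * mpow ρ (1 / 2) = P := by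
      have := mpow_mul_mpow_neg hρ (s := -(1 / 2)) (by norm_num)
      rwa [neg_neg] at this
    rw [← Matrix.mul_assoc, e, Matrix.mul_assoc,
      mpow_mul_mpow hσ (u := 1 / (2 * a)) (by field_simp; ring) (by positivity)]
  have hpow : ∀ C : ℝ, 0 < C → Tendsto (fun a : ℝ => C ^ a) (𝓝[>] 0) (𝓝 1) := by
    intro C hC
    have := (Real.continuousAt_const_rpow (a := C) (b := 0) hC.ne').tendsto
    rw [Real.rpow_zero] at this
    exact this.mono_left nhdsWithin_le_nhds
  have hev : ∀ᶠ a : ℝ in 𝓝[>] 0, a ∈ Set.Ioo (0 : ℝ) 1 := Ioo_mem_nhdsGT one_pos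
  refine tendsto_of_tendsto_of_tendsto_of_le_of_le'
    (g := fun a => ((c3 * c4) ^ a)⁻¹ * G a) (h := fun a => (c1 * c2) ^ a * G a) ?_ ?_ ?_ ?_
  · simpa using ((hpow _ (mul_pos hc3 hc4)).inv₀ one_ne_zero).mul hL
  · simpa using (hpow _ (mul_pos hc1 hc2)).mul hL
  · filter_upwards [hev] with a ha
    rw [inv_mul_le_iff₀ (Real.rpow_pos_of_pos (mul_pos hc3 hc4) a)]
    exact hlow a ha
  · filter_upwards [hev] with a ha using hup a ha

end

/-! ### Limits of the Petz divergence -/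

section

variable {n : Type*} [Fintype n] [DecidableEq n] {ρ σ : Matrix n n ℂ}

omit [DecidableEq n] in
theorem dominates_iff : Dominates σ ρ ↔ ∀ x, σ *ᵥ x = 0 → ρ *ᵥ x = 0 := Iff.rfl

/-- The expansion of the Petz trace functional in eigenbases of both arguments. -/
theorem exists_petzQ_eq_sum (hρ : ρ.PosSemidef) (hσ : σ.PosSemidef) :
    ∃ (c : n → n → ℝ) (l m : n → ℝ), (∀ i j, 0 ≤ c i j) ∧ (∀ i, 0 ≤ l i) ∧ (∀ j, 0 ≤ m j) ∧
      (∀ a, petzQ a ρ σ = ∑ i, ∑ j, c i j * (l i ^ a * m j ^ (1 - a))) ∧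
      (Dominates σ ρ ↔ ∀ i j, m j = 0 → c i j * l i = 0) := by
  obtain ⟨U, hU, hU1, hU2, hUρ⟩ := exists_diagonalization hρ.1
  obtain ⟨W, hW, hW1, hW2, hWσ⟩ := exists_diagonalization hσ.1
  set l := hρ.1.eigenvalues
  set m := hσ.1.eigenvalues
  set C := Uᴴ * W with hC
  refine ⟨fun i j => Complex.normSq (C i j), l, m, fun i j => Complex.normSq_nonneg _,
    hρ.eigenvalues_nonneg, hσ.eigenvalues_nonneg, fun a => ?_, ?_⟩
  · have e : (mpow ρ a * mpow σ (1 - a)).trace =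
        (diagonal (fun i => ((l i ^ a : ℝ) : ℂ)) *
          (C * diagonal (fun j => ((m j ^ (1 - a) : ℝ) : ℂ)) * Cᴴ)).trace := by
      rw [mpow_eq hρ, mpow_eq hσ, ← hU, ← hW, hC, conjTranspose_mul, conjTranspose_conjTranspose]
      simp only [Matrix.mul_assoc]
      rw [trace_mul_comm U]
      simp only [Matrix.mul_assoc]
      rfl
    rw [petzQ, e, trace, Complex.re_sum]
    refine sum_congr rfl fun i _ => ?_
    rw [diag_apply, diagonal_mul, Complex.re_ofReal_mul, mul_apply, Complex.re_sum, mul_sum]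
    refine sum_congr rfl fun j _ => ?_
    rw [mul_diagonal, conjTranspose_apply, mul_right_comm, Complex.star_def, Complex.mul_conj,
      ← Complex.ofReal_mul, Complex.ofReal_re]
    ring
  · have hρx : ∀ x, ρ *ᵥ x = 0 ↔ ∀ i, (l i : ℂ) * (C *ᵥ (Wᴴ *ᵥ x)) i = 0 := by
      intro x
      have h1 : ρ *ᵥ x = U *ᵥ (diagonal (fun i => (l i : ℂ)) *ᵥ (C *ᵥ (Wᴴ *ᵥ x))) := by
        conv_lhs => rw [hUρ]
        simp only [mulVec_mulVec, hC]
        congr 1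
        simp only [Matrix.mul_assoc]
        rw [hW2, Matrix.mul_one]
      rw [h1]
      constructor
      · intro h i
        have := congrArg (Uᴴ *ᵥ ·) h
        simp only [mulVec_mulVec, ← Matrix.mul_assoc, hU1, Matrix.one_mul, mulVec_zero] at this
        have := congrFun this i
        simp only [← mulVec_mulVec, mulVec_diagonal] at this
        simpa using this
      · intro h
        have : diagonal (fun i => (l i : ℂ)) *ᵥ (C *ᵥ (Wᴴ *ᵥ x)) = 0 := by
          ext i; rw [mulVec_diagonal]; exact h i
        rw [this, mulVec_zero]
    have hσx : ∀ x, σ *ᵥ x = 0 ↔ ∀ j, (m j : ℂ) * (Wᴴ *ᵥ x) j = 0 := by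
      intro x
      have h1 : σ *ᵥ x = W *ᵥ (diagonal (fun i => (m i : ℂ)) *ᵥ (Wᴴ *ᵥ x)) := by
        conv_lhs => rw [hWσ]
        simp only [mulVec_mulVec, Matrix.mul_assoc]
      rw [h1]
      constructor
      · intro h i
        have := congrArg (Wᴴ *ᵥ ·) h
        simp only [mulVec_mulVec, ← Matrix.mul_assoc, hW1, Matrix.one_mul, mulVec_zero] at this
        have := congrFun this i
        simp only [← mulVec_mulVec, mulVec_diagonal] at this
        simpa using this
      · intro h
        have : diagonal (fun i => (m i : ℂ)) *ᵥ (Wᴴ *ᵥ x) = 0 := by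
          ext i; rw [mulVec_diagonal]; exact h i
        rw [this, mulVec_zero]
    rw [dominates_iff]
    constructor
    · intro h i j hj
      -- The test vector is the `j`-th eigenvector of `σ`.
      have hy : Wᴴ *ᵥ (W *ᵥ Pi.single j 1) = Pi.single j 1 := by
        rw [mulVec_mulVec, hW1, one_mulVec]
      have h1 := (hρx _).1 (h (W *ᵥ Pi.single j 1) ((hσx _).2 fun j' => by
        rw [hy]
        by_cases hjj : j' = j
        · subst hjj; simp [hj]
        · simp [hjj])) i
      rw [hy, mulVec_single_one] at h1
      rcases mul_eq_zero.1 h1 with h2 | h2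
      · rw [Complex.ofReal_eq_zero.1 h2, mul_zero]
      · have h2 : C i j = 0 := h2
        simp [h2]
    · intro h x hx
      rw [hρx]
      rw [hσx] at hx
      intro i
      rw [mulVec, dotProduct, mul_sum]
      refine sum_eq_zero fun j _ => ?_
      rcases mul_eq_zero.1 (hx j) with h1 | h1
      · rcases mul_eq_zero.1 (h i j (Complex.ofReal_eq_zero.1 h1)) with h2 | h2
        · simp [Complex.normSq_eq_zero.1 h2]
        · simp [h2]
      · simp [h1]

theorem exists_tendsto_petzQ_zero (hρ : ρ.PosSemidef) (hσ : σ.PosSemidef) :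
    ∃ L, Tendsto (fun a => petzQ a ρ σ) (𝓝[>] 0) (𝓝 L) := by
  obtain ⟨c, l, m, -, -, -, hQ, -⟩ := exists_petzQ_eq_sum hρ hσ
  refine ⟨∑ i, ∑ j, c i j * ((if l i = 0 then 0 else 1) * m j ^ (1 - 0 : ℝ)), ?_⟩
  simp only [hQ]
  refine tendsto_finsetSum _ fun i _ => tendsto_finsetSum _ fun j _ => ?_
  refine (Tendsto.mul ?_ ?_).const_mul _
  · split_ifs with h
    · refine tendsto_const_nhds.congr' ?_
      filter_upwards [self_mem_nhdsWithin] with a ha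
      rw [h, Real.zero_rpow (ne_of_gt ha)]
    · have := (Real.continuousAt_const_rpow (b := 0) h).tendsto
      rw [Real.rpow_zero] at this
      exact this.mono_left nhdsWithin_le_nhds
  · have h1 : ContinuousAt (fun a : ℝ => m j ^ (1 - a)) 0 :=
      ContinuousAt.comp (f := fun a : ℝ => 1 - a) (g := fun b => m j ^ b)
        (Real.continuousAt_const_rpow' (by norm_num)) (by fun_prop)
    exact h1.tendsto.mono_left nhdsWithin_le_nhds

/-- Dropping the terms with a zero eigenvalue removes the jump of `0 ^ (1 - a)` at `a = 1`. The
value `F 1` is then the weight of `ρ` on the support of `σ`, which is all of `tr ρ` exactly under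
domination. -/
theorem exists_petzQ_extension (hρ : ρ.PosSemidef) (hσ : σ.PosSemidef) :
    ∃ F : ℝ → ℝ, DifferentiableAt ℝ F 1 ∧ (∀ a, a ≠ 0 → a ≠ 1 → petzQ a ρ σ = F a) ∧
      (Dominates σ ρ → F 1 = ρ.trace.re) ∧ (¬ Dominates σ ρ → F 1 < ρ.trace.re) := by
  obtain ⟨c, l, m, hc, hl, hm, hQ, hdom⟩ := exists_petzQ_eq_sum hρ hσ
  -- At order `1` the convention `0 ^ 0 = 1` makes `mpow σ 0` the identity, so `petzQ` there is the
  -- full trace of `ρ`.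
  have htr : ρ.trace.re = ∑ i, ∑ j, c i j * l i := by
    have := hQ 1
    rw [petzQ, mpow_one hρ, sub_self, mpow_zero hσ, Matrix.mul_one] at this
    simpa using this
  refine ⟨fun a => ∑ i, ∑ j, c i j * (if l i = 0 ∨ m j = 0 then 0 else l i ^ a * m j ^ (1 - a)),
    ?_, fun a h0 h1 => ?_, fun h => ?_, fun h => ?_⟩
  · refine DifferentiableAt.fun_sum fun i _ => DifferentiableAt.fun_sum fun j _ => ?_
    refine DifferentiableAt.const_mul ?_ _
    split_ifs with h
    · exact differentiableAt_const _
    · push Not at h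
      have hl' : 0 < l i := (hl i).lt_of_ne' h.1
      have hm' : 0 < m j := (hm j).lt_of_ne' h.2
      exact (((hasDerivAt_id (1 : ℝ)).const_rpow hl').mul
        (((hasDerivAt_id (1 : ℝ)).const_sub 1).const_rpow hm')).differentiableAt
  · rw [hQ]
    refine sum_congr rfl fun i _ => sum_congr rfl fun j _ => ?_
    split_ifs with h
    · rcases h with h | h
      · rw [h, Real.zero_rpow h0, zero_mul]
      · rw [h, Real.zero_rpow (sub_ne_zero.2 h1.symm), mul_zero]
    · rfl
  · rw [htr]
    refine sum_congr rfl fun i _ => sum_congr rfl fun j _ => ?_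
    split_ifs with h1
    · rcases h1 with h1 | h1
      · rw [h1]
      · rw [hdom.1 h i j h1, mul_zero]
    · simp
  · rw [hdom] at h
    push Not at h
    obtain ⟨i, j, hj, hne⟩ := h
    have hle : ∀ i j, c i j * (if l i = 0 ∨ m j = 0 then 0 else l i ^ (1 : ℝ) * m j ^ (1 - 1 : ℝ))
        ≤ c i j * l i := by
      intro i j
      refine mul_le_mul_of_nonneg_left ?_ (hc i j)
      split_ifs with h
      · exact hl i
      · simp
    rw [htr]
    refine sum_lt_sum (fun i _ => sum_le_sum fun j _ => hle i j) ⟨i, mem_univ _, ?_⟩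
    refine sum_lt_sum (fun j _ => hle i j) ⟨j, mem_univ _, ?_⟩
    rw [if_pos (Or.inr hj), mul_zero]
    exact (mul_nonneg (hc i j) (hl i)).lt_of_ne' hne

omit [DecidableEq n] in
theorem divergenceOfQ_eq {Q α : ℝ} (hρ1 : ρ.trace.re = 1) (h : Dominates σ ρ ∨ α < 1) :
    divergenceOfQ Q α ρ σ =
      ((1 / (α - 1) : ℝ) : EReal) * ENNReal.log (ENNReal.ofReal Q) := by
  rw [divergenceOfQ, if_pos h, hρ1, one_div_one, one_mul]

omit [DecidableEq n] in
theorem divergenceOfQ_of_pos {Q α : ℝ} (hρ1 : ρ.trace.re = 1) (h : Dominates σ ρ ∨ α < 1)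
    (hQ : 0 < Q) : divergenceOfQ Q α ρ σ = ((1 / (α - 1) * Real.log Q : ℝ) : EReal) := by
  rw [divergenceOfQ_eq hρ1 h, ENNReal.log_ofReal_of_pos hQ, EReal.coe_mul]

omit [DecidableEq n] in
theorem divergenceOfQ_of_nonpos {Q α : ℝ} (hρ1 : ρ.trace.re = 1) (h : α < 1)
    (hQ : Q ≤ 0) : divergenceOfQ Q α ρ σ = ⊤ := by
  rw [divergenceOfQ_eq hρ1 (Or.inr h), ENNReal.ofReal_of_nonpos hQ, ENNReal.log_zero,
    EReal.coe_mul_bot_of_neg (one_div_neg.2 (sub_neg.2 h))]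

omit [DecidableEq n] in
theorem divergenceOfQ_anti {Q Q' α : ℝ} (hρ1 : ρ.trace.re = 1) (h : α < 1) (hQ : Q ≤ Q') :
    divergenceOfQ Q' α ρ σ ≤ divergenceOfQ Q α ρ σ := by
  rcases le_or_gt Q 0 with h0 | h0
  · rw [divergenceOfQ_of_nonpos hρ1 h h0]; exact le_top
  · rw [divergenceOfQ_of_pos hρ1 (Or.inr h) h0,
      divergenceOfQ_of_pos hρ1 (Or.inr h) (h0.trans_le hQ), EReal.coe_le_coe_iff]
    exact mul_le_mul_of_nonpos_left (Real.log_le_log h0 hQ) (one_div_neg.2 (sub_neg.2 h)).le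

omit [DecidableEq n] in
theorem divergenceOfQ_mono {Q Q' α : ℝ} (hρ1 : ρ.trace.re = 1) (h : 1 < α) (hQ : Q ≤ Q') :
    divergenceOfQ Q α ρ σ ≤ divergenceOfQ Q' α ρ σ := by
  by_cases hd : Dominates σ ρ
  · rw [divergenceOfQ_eq hρ1 (Or.inl hd), divergenceOfQ_eq hρ1 (Or.inl hd)]
    refine mul_le_mul_of_nonneg_left (ENNReal.log_monotone (ENNReal.ofReal_le_ofReal hQ)) ?_
    exact EReal.coe_nonneg.2 (one_div_nonneg.2 (sub_nonneg.2 h.le))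
  · rw [divergenceOfQ, divergenceOfQ, if_neg, if_neg] <;> simp [hd, h.le]

omit [DecidableEq n] in
-- The prefactor tends to `-1`, finite and nonzero, so multiplication in `EReal` is continuous here
-- even when `L = 0`.
theorem tendsto_divergenceOfQ_zero {Q : ℝ → ℝ} {L : ℝ} (hρ1 : ρ.trace.re = 1)
    (hQ : Tendsto Q (𝓝[>] 0) (𝓝 L)) :
    Tendsto (fun a => divergenceOfQ (Q a) a ρ σ) (𝓝[>] 0)
      (𝓝 (((1 / (0 - 1) : ℝ) : EReal) * ENNReal.log (ENNReal.ofReal L))) := by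
  have h1 : Tendsto (fun a : ℝ => ((1 / (a - 1) : ℝ) : EReal)) (𝓝[>] 0)
      (𝓝 ((1 / (0 - 1) : ℝ) : EReal)) := by
    refine EReal.tendsto_coe.2 (Tendsto.mono_left ?_ nhdsWithin_le_nhds)
    exact (ContinuousAt.div continuousAt_const (by fun_prop) (by norm_num)).tendsto
  have h2 : Tendsto (fun a => ENNReal.log (ENNReal.ofReal (Q a))) (𝓝[>] 0)
      (𝓝 (ENNReal.log (ENNReal.ofReal L))) :=
    (ENNReal.continuous_log.tendsto _).comp (ENNReal.tendsto_ofReal hQ)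
  have hne : ((1 / (0 - 1) : ℝ) : EReal) ≠ 0 := by
    rw [Ne, EReal.coe_eq_zero]; norm_num
  have h3 := EReal.Tendsto.mul h1 h2 (Or.inl hne) (Or.inl hne) (Or.inl (EReal.coe_ne_bot _))
    (Or.inl (EReal.coe_ne_top _))
  refine h3.congr' ?_
  filter_upwards [Ioo_mem_nhdsGT (zero_lt_one (α := ℝ))] with a ha
  rw [divergenceOfQ_eq hρ1 (Or.inr ha.2)]

/-- Under domination `F 1 = 1`, and the divergence is the difference quotient of `log F` at `1`.
Otherwise it is `⊤` above `1` by definition, and below `1` the prefactor tends to `-∞` against a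
negative logarithm. -/
theorem exists_tendsto_petz_one (hρ : ρ.PosSemidef) (hρ1 : ρ.trace.re = 1) (hσ : σ.PosSemidef) :
    ∃ ℓ : EReal, Tendsto (fun a => divergenceOfQ (petzQ a ρ σ) a ρ σ) (𝓝[≠] 1) (𝓝 ℓ) := by
  obtain ⟨F, hF, hQ, hd1, hd2⟩ := exists_petzQ_extension hρ hσ
  have hne0 : ∀ᶠ a : ℝ in 𝓝[≠] 1, a ≠ 0 :=
    (isOpen_ne.eventually_mem one_ne_zero).filter_mono nhdsWithin_le_nhds
  by_cases hd : Dominates σ ρ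
  · have hF1 : F 1 = 1 := (hd1 hd).trans hρ1
    have hlog : HasDerivAt (fun a => Real.log (F a)) (deriv (fun a => Real.log (F a)) 1) 1 :=
      (hF.log (by rw [hF1]; exact one_ne_zero)).hasDerivAt
    refine ⟨((deriv (fun a => Real.log (F a)) 1 : ℝ) : EReal), ?_⟩
    refine (EReal.tendsto_coe.2 (hasDerivAt_iff_tendsto_slope.1 hlog)).congr' ?_
    have hpos : ∀ᶠ a in 𝓝[≠] 1, 0 < F a :=
      (hF.continuousAt.eventually (isOpen_Ioi.mem_nhds (show (0 : ℝ) < F 1 by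
        rw [hF1]; exact one_pos))).filter_mono nhdsWithin_le_nhds
    filter_upwards [hne0, hpos, self_mem_nhdsWithin] with a h0 hp h1
    rw [hQ a h0 h1, divergenceOfQ_of_pos hρ1 (Or.inl hd) hp, slope_def_field, hF1, Real.log_one,
      sub_zero, one_div, div_eq_inv_mul]
  · refine ⟨⊤, ?_⟩
    have hF1 : F 1 < 1 := (hd2 hd).trans_eq hρ1
    rw [← nhdsLT_sup_nhdsGT, tendsto_sup]
    constructor
    · have h1 : Tendsto (fun a : ℝ => ((1 / (a - 1) : ℝ) : EReal)) (𝓝[<] 1) (𝓝 ⊥) := by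
        rw [EReal.tendsto_coe_nhds_bot_iff]
        simp only [one_div]
        refine tendsto_inv_nhdsLT_zero.comp ?_
        refine tendsto_nhdsWithin_iff.2 ⟨?_, ?_⟩
        · have : Tendsto (fun a : ℝ => a - 1) (𝓝 1) (𝓝 (1 - 1)) :=
            (continuous_id.sub continuous_const).tendsto 1
          rw [sub_self] at this
          exact this.mono_left nhdsWithin_le_nhds
        · filter_upwards [self_mem_nhdsWithin] with a ha using sub_neg.2 (Set.mem_Iio.1 ha)
      have h2 : Tendsto (fun a => ENNReal.log (ENNReal.ofReal (F a))) (𝓝[<] 1)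
          (𝓝 (ENNReal.log (ENNReal.ofReal (F 1)))) :=
        (ENNReal.continuous_log.tendsto _).comp (ENNReal.tendsto_ofReal
          (hF.continuousAt.tendsto.mono_left nhdsWithin_le_nhds))
      have hneg : ENNReal.log (ENNReal.ofReal (F 1)) < 0 := by
        rw [ENNReal.log_lt_zero_iff]; exact ENNReal.ofReal_lt_one.2 hF1
      have h3 := EReal.Tendsto.mul h1 h2 (Or.inl (by simp)) (Or.inl (by simp))
        (Or.inr hneg.ne) (Or.inr hneg.ne)
      rw [EReal.bot_mul_of_neg hneg] at h3
      refine h3.congr' ?_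
      filter_upwards [Ioo_mem_nhdsLT (zero_lt_one (α := ℝ))] with a ha
      rw [hQ a ha.1.ne' ha.2.ne, divergenceOfQ_eq hρ1 (Or.inr ha.2)]
    · refine tendsto_const_nhds.congr' ?_
      filter_upwards [self_mem_nhdsWithin] with a ha
      have ha : 1 < a := ha
      rw [divergenceOfQ, if_neg]
      simp [hd, ha.le]

end

/-! ### Comparison of the divergences and their limits -/

section Divergences

variable {n : Type*} [Fintype n] [DecidableEq n] {ρ σ : Matrix n n ℂ} {a : ℝ}

theorem petzDivergence_of_ne (h0 : a ≠ 0) (h1 : a ≠ 1) :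
    petzDivergence a ρ σ = divergenceOfQ (petzQ a ρ σ) a ρ σ := by
  rw [petzDivergence, if_neg h0, if_neg h1]

theorem minimalDivergence_of_ne (h0 : a ≠ 0) (h1 : a ≠ 1) :
    minimalDivergence a ρ σ = divergenceOfQ (minimalQ a ρ σ) a ρ σ := by
  rw [minimalDivergence, if_neg h0, if_neg h1]

theorem eventually_ne_zero_one_nhdsGT : ∀ᶠ a : ℝ in 𝓝[>] 0, a ≠ 0 ∧ a ≠ 1 := by
  filter_upwards [Ioo_mem_nhdsGT (zero_lt_one (α := ℝ))] with a ha using ⟨ha.1.ne', ha.2.ne⟩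

theorem eventually_ne_zero_one_nhdsNE : ∀ᶠ a : ℝ in 𝓝[≠] 1, a ≠ 0 ∧ a ≠ 1 := by
  have hne0 : ∀ᶠ a : ℝ in 𝓝[≠] 1, a ≠ 0 :=
    (isOpen_ne.eventually_mem one_ne_zero).filter_mono nhdsWithin_le_nhds
  filter_upwards [hne0, self_mem_nhdsWithin] with a h0 h1 using ⟨h0, h1⟩

theorem tendsto_petzDivergence_zero (hρ : ρ.PosSemidef) (hρ1 : ρ.trace.re = 1)
    (hσ : σ.PosSemidef) :
    Tendsto (fun a => petzDivergence a ρ σ) (𝓝[>] 0) (𝓝 (petzDivergence 0 ρ σ)) := by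
  obtain ⟨L, hL⟩ := exists_tendsto_petzQ_zero hρ hσ
  have h := tendsto_divergenceOfQ_zero (ρ := ρ) (σ := σ) hρ1 hL
  rw [petzDivergence, if_pos rfl, h.limUnder_eq]
  refine h.congr' ?_
  filter_upwards [eventually_ne_zero_one_nhdsGT] with a ha
  rw [petzDivergence_of_ne ha.1 ha.2]

theorem tendsto_minimalDivergence_zero (hρ : ρ.PosSemidef) (hρ1 : ρ.trace.re = 1)
    (hσ : σ.PosSemidef) :
    Tendsto (fun a => minimalDivergence a ρ σ) (𝓝[>] 0) (𝓝 (minimalDivergence 0 ρ σ)) := by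
  obtain ⟨L, hL⟩ := exists_tendsto_minimalQ_zero hρ hσ
  have h := tendsto_divergenceOfQ_zero (ρ := ρ) (σ := σ) hρ1 hL
  rw [minimalDivergence, if_pos rfl, h.limUnder_eq]
  refine h.congr' ?_
  filter_upwards [eventually_ne_zero_one_nhdsGT] with a ha
  rw [minimalDivergence_of_ne ha.1 ha.2]

theorem tendsto_petzDivergence_one (hρ : ρ.PosSemidef) (hρ1 : ρ.trace.re = 1)
    (hσ : σ.PosSemidef) :
    Tendsto (fun a => petzDivergence a ρ σ) (𝓝[≠] 1) (𝓝 (petzDivergence 1 ρ σ)) := by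
  obtain ⟨ℓ, h⟩ := exists_tendsto_petz_one hρ hρ1 hσ
  rw [petzDivergence, if_neg one_ne_zero, if_pos rfl, h.limUnder_eq]
  refine h.congr' ?_
  filter_upwards [eventually_ne_zero_one_nhdsNE] with a ha
  rw [petzDivergence_of_ne ha.1 ha.2]

theorem minimalDivergence_le_petzDivergence_of_lt (hρ : ρ.PosSemidef) (hρ1 : ρ.trace.re = 1)
    (hσ : σ.PosSemidef) (h0 : 0 < a) (h1 : a < 1) :
    minimalDivergence a ρ σ ≤ petzDivergence a ρ σ := by
  rw [petzDivergence_of_ne h0.ne' h1.ne, minimalDivergence_of_ne h0.ne' h1.ne]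
  exact divergenceOfQ_anti hρ1 h1 (petzQ_le_minimalQ hρ hσ h0 h1)

theorem minimalDivergence_le_petzDivergence_of_gt (hρ : ρ.PosSemidef) (hρ1 : ρ.trace.re = 1)
    (hσ : σ.PosSemidef) (h1 : 1 < a) :
    minimalDivergence a ρ σ ≤ petzDivergence a ρ σ := by
  have h0 : 0 < a := one_pos.trans h1
  rw [petzDivergence_of_ne h0.ne' h1.ne', minimalDivergence_of_ne h0.ne' h1.ne']
  exact divergenceOfQ_mono hρ1 h1 (minimalQ_le_petzQ hρ hσ h1)

theorem petzDivergence_le_minimalDivergence (hρ : ρ.PosSemidef) (hρ1 : ρ.trace.re = 1)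
    (hσ : σ.PosSemidef) (h1 : 1 < a) :
    petzDivergence (2 - 1 / a) ρ σ ≤ minimalDivergence a ρ σ := by
  have h0 : 0 < a := one_pos.trans h1
  have h2 : 1 / a < 1 := (div_lt_one h0).2 h1
  rw [petzDivergence_of_ne (by linarith) (by linarith), minimalDivergence_of_ne h0.ne' h1.ne']
  by_cases hd : Dominates σ ρ
  · have hQ := petzQ_le_rpow_minimalQ hρ hρ1 hσ h1
    have hpos : 0 < 1 / (2 - 1 / a - 1) := one_div_pos.2 (by linarith)
    rcases le_or_gt (petzQ (2 - 1 / a) ρ σ) 0 with hp | hp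
    · rw [divergenceOfQ_eq hρ1 (Or.inl hd), ENNReal.ofReal_of_nonpos hp, ENNReal.log_zero,
        EReal.coe_mul_bot_of_pos hpos]
      exact bot_le
    · have hm : 0 < minimalQ a ρ σ := by
        refine (minimalQ_nonneg hρ hσ).lt_of_ne' fun h => ?_
        rw [h, Real.zero_rpow (one_div_pos.2 h0).ne'] at hQ
        exact hp.not_ge hQ
      rw [divergenceOfQ_of_pos hρ1 (Or.inl hd) hp, divergenceOfQ_of_pos hρ1 (Or.inl hd) hm,
        EReal.coe_le_coe_iff]
      have h3 := Real.log_le_log hp hQ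
      rw [Real.log_rpow hm] at h3
      refine (mul_le_mul_of_nonneg_left h3 hpos.le).trans_eq ?_
      have : a - 1 ≠ 0 := (sub_pos.2 h1).ne'
      -- The exponent `1 / a` from Hölder turns the Petz prefactor `a / (a - 1)` into `1 / (a - 1)`.
      have : 2 - 1 / a - 1 = (a - 1) / a := by field_simp; ring
      rw [this]
      field_simp
  · have : divergenceOfQ (minimalQ a ρ σ) a ρ σ = ⊤ := by
      rw [divergenceOfQ, if_neg]; simp [hd, h1.le]
    rw [this]; exact le_top

/-- Serves order `0`, where the limit of `a * -D` in the general bound could be of the form `0 · ∞`.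
-/
theorem neg_minimalDivergence_le_log (hρ : ρ.PosSemidef) (hρ1 : ρ.trace.re = 1)
    (hσ : σ.PosSemidef) (hσ0 : 0 < σ.trace.re) (h0 : 0 < a) (h1 : a < 1) :
    -minimalDivergence a ρ σ ≤ (Real.log σ.trace.re : EReal) := by
  rw [minimalDivergence_of_ne h0.ne' h1.ne]
  rcases le_or_gt (minimalQ a ρ σ) 0 with hm | hm
  · rw [divergenceOfQ_of_nonpos hρ1 h1 hm]; simp
  · rw [divergenceOfQ_of_pos hρ1 (Or.inr h1) hm, ← EReal.coe_neg, EReal.coe_le_coe_iff]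
    have h2 := Real.log_le_log hm (minimalQ_le_rpow_trace hρ hρ1 hσ h0 h1)
    rw [Real.log_rpow hσ0] at h2
    have h3 : 0 < 1 - a := sub_pos.2 h1
    have e : -(1 / (a - 1) * Real.log (minimalQ a ρ σ)) = Real.log (minimalQ a ρ σ) / (1 - a) := by
      rw [← neg_sub 1 a]; field_simp
    rw [e, div_le_iff₀ h3, mul_comm]
    exact h2

theorem neg_minimalDivergence_le (hρ : ρ.PosSemidef) (hρ1 : ρ.trace.re = 1)
    (hσ : σ.PosSemidef) (hσ0 : 0 < σ.trace.re) (h0 : 0 < a) (h1 : a < 1) :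
    -minimalDivergence a ρ σ ≤
      (a : EReal) * -petzDivergence a ρ σ + (((1 - a) * Real.log σ.trace.re : ℝ) : EReal) := by
  rw [minimalDivergence_of_ne h0.ne' h1.ne, petzDivergence_of_ne h0.ne' h1.ne]
  rcases le_or_gt (minimalQ a ρ σ) 0 with hm | hm
  · rw [divergenceOfQ_of_nonpos hρ1 h1 hm]; simp
  · have hQ := minimalQ_le_rpow_petzQ hρ hρ1 hσ h0 h1
    have hp : 0 < petzQ a ρ σ := by
      refine (petzQ_nonneg hρ hσ h0.ne' h1.ne).lt_of_ne' fun h => ?_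
      rw [h, Real.zero_rpow h0.ne', zero_mul] at hQ
      exact hm.not_ge hQ
    rw [divergenceOfQ_of_pos hρ1 (Or.inr h1) hm, divergenceOfQ_of_pos hρ1 (Or.inr h1) hp,
      ← EReal.coe_neg, ← EReal.coe_neg, ← EReal.coe_mul, ← EReal.coe_add, EReal.coe_le_coe_iff]
    have h2 := Real.log_le_log hm hQ
    rw [Real.log_mul (Real.rpow_pos_of_pos hp _).ne' (Real.rpow_pos_of_pos hσ0 _).ne',
      Real.log_rpow hp, Real.log_rpow hσ0] at h2
    have h3 : 0 < 1 - a := sub_pos.2 h1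
    have e : ∀ x : ℝ, -(1 / (a - 1) * x) = x / (1 - a) := by
      intro x; rw [← neg_sub 1 a]; field_simp
    rw [e, e, div_le_iff₀ h3]
    refine h2.trans_eq ?_
    field_simp

/-- From the left, the two sides of the main bound share their limit. From the right, the minimal
divergence lies between the Petz divergences of orders `2 - 1/a` and `a`, and both orders decrease
to `1`. -/
theorem tendsto_minimalDivergence_petzDivergence_one (hρ : ρ.PosSemidef) (hρ1 : ρ.trace.re = 1)
    (hσ : σ.PosSemidef) (hσ0 : 0 < σ.trace.re) :
    Tendsto (fun a => minimalDivergence a ρ σ) (𝓝[≠] 1) (𝓝 (petzDivergence 1 ρ σ)) := by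
  have hpetz := tendsto_petzDivergence_one hρ hρ1 hσ
  rw [← nhdsLT_sup_nhdsGT, tendsto_sup] at hpetz ⊢
  constructor
  · have hneg : Tendsto (fun a => -petzDivergence a ρ σ) (𝓝[<] 1) (𝓝 (-petzDivergence 1 ρ σ)) :=
      (continuous_neg.tendsto _).comp hpetz.1
    have hupper : Tendsto (fun a : ℝ => (a : EReal) * -petzDivergence a ρ σ +
        (((1 - a) * Real.log σ.trace.re : ℝ) : EReal)) (𝓝[<] 1) (𝓝 (-petzDivergence 1 ρ σ)) := by
      have h1 : Tendsto (fun a : ℝ => (a : EReal)) (𝓝[<] 1) (𝓝 ((1 : ℝ) : EReal)) :=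
        EReal.tendsto_coe.2 nhdsWithin_le_nhds
      have h2 := EReal.Tendsto.mul h1 hneg (Or.inl (by simp)) (Or.inl (by simp))
        (Or.inl (EReal.coe_ne_bot _)) (Or.inl (EReal.coe_ne_top _))
      have h3 : Tendsto (fun a : ℝ => (((1 - a) * Real.log σ.trace.re : ℝ) : EReal)) (𝓝[<] 1)
          (𝓝 (((1 - 1) * Real.log σ.trace.re : ℝ) : EReal)) :=
        EReal.tendsto_coe.2 (((continuous_const.sub continuous_id).mul
          continuous_const).tendsto' 1 _ rfl |>.mono_left nhdsWithin_le_nhds)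
      have h4 := (EReal.continuousAt_add (p := (((1 : ℝ) : EReal) * -petzDivergence 1 ρ σ,
        (((1 - 1) * Real.log σ.trace.re : ℝ) : EReal))) (Or.inr (EReal.coe_ne_bot _))
        (Or.inr (EReal.coe_ne_top _))).tendsto.comp (h2.prodMk_nhds h3)
      simpa [Function.comp_def] using h4
    have hlim : Tendsto (fun a => -minimalDivergence a ρ σ) (𝓝[<] 1)
        (𝓝 (-petzDivergence 1 ρ σ)) := by
      refine tendsto_of_tendsto_of_tendsto_of_le_of_le' hneg hupper ?_ ?_
      · filter_upwards [Ioo_mem_nhdsLT (zero_lt_one (α := ℝ))] with a ha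
        exact EReal.neg_le_neg_iff.2 (minimalDivergence_le_petzDivergence_of_lt hρ hρ1 hσ ha.1 ha.2)
      · filter_upwards [Ioo_mem_nhdsLT (zero_lt_one (α := ℝ))] with a ha
        exact neg_minimalDivergence_le hρ hρ1 hσ hσ0 ha.1 ha.2
    have := (continuous_neg.tendsto _).comp hlim
    simpa [Function.comp_def] using this
  · have hmap : Tendsto (fun a : ℝ => 2 - 1 / a) (𝓝[>] 1) (𝓝[>] 1) := by
      refine tendsto_nhdsWithin_iff.2 ⟨?_, ?_⟩
      · have : ContinuousAt (fun a : ℝ => 2 - 1 / a) 1 :=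
          continuousAt_const.sub (continuousAt_const.div continuousAt_id one_ne_zero)
        have := this.tendsto
        norm_num at this
        simpa using this.mono_left nhdsWithin_le_nhds
      · filter_upwards [self_mem_nhdsWithin] with a ha
        have ha : 1 < a := ha
        have : 1 / a < 1 := (div_lt_one (one_pos.trans ha)).2 ha
        show 1 < 2 - 1 / a
        linarith
    refine tendsto_of_tendsto_of_tendsto_of_le_of_le' (hpetz.2.comp hmap) hpetz.2 ?_ ?_
    · filter_upwards [self_mem_nhdsWithin] with a ha
      exact petzDivergence_le_minimalDivergence hρ hρ1 hσ ha
    · filter_upwards [self_mem_nhdsWithin] with a ha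
      exact minimalDivergence_le_petzDivergence_of_gt hρ hρ1 hσ ha

theorem minimalDivergence_one (hρ : ρ.PosSemidef) (hρ1 : ρ.trace.re = 1)
    (hσ : σ.PosSemidef) (hσ0 : 0 < σ.trace.re) :
    minimalDivergence 1 ρ σ = petzDivergence 1 ρ σ := by
  rw [minimalDivergence, if_neg one_ne_zero, if_pos rfl]
  refine ((tendsto_minimalDivergence_petzDivergence_one hρ hρ1 hσ hσ0).congr' ?_).limUnder_eq
  filter_upwards [eventually_ne_zero_one_nhdsNE] with a ha
  rw [minimalDivergence_of_ne ha.1 ha.2]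

theorem neg_petzDivergence_le_neg_minimalDivergence (hρ : ρ.PosSemidef) (hρ1 : ρ.trace.re = 1)
    (hσ : σ.PosSemidef) (hσ0 : 0 < σ.trace.re) (h0 : 0 ≤ a) (h1 : a ≤ 1) :
    -petzDivergence a ρ σ ≤ -minimalDivergence a ρ σ := by
  rw [EReal.neg_le_neg_iff]
  rcases h0.eq_or_lt with rfl | h0
  · refine le_of_tendsto_of_tendsto (tendsto_minimalDivergence_zero hρ hρ1 hσ)
      (tendsto_petzDivergence_zero hρ hρ1 hσ) ?_
    filter_upwards [Ioo_mem_nhdsGT (zero_lt_one (α := ℝ))] with a ha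
    exact minimalDivergence_le_petzDivergence_of_lt hρ hρ1 hσ ha.1 ha.2
  rcases h1.eq_or_lt with rfl | h1
  · exact (minimalDivergence_one hρ hρ1 hσ hσ0).le
  · exact minimalDivergence_le_petzDivergence_of_lt hρ hρ1 hσ h0 h1

theorem neg_minimalDivergence_le_of_le_one (hρ : ρ.PosSemidef) (hρ1 : ρ.trace.re = 1)
    (hσ : σ.PosSemidef) (hσ0 : 0 < σ.trace.re) (h0 : 0 ≤ a) (h1 : a ≤ 1) :
    -minimalDivergence a ρ σ ≤
      (a : EReal) * -petzDivergence a ρ σ + (((1 - a) * Real.log σ.trace.re : ℝ) : EReal) := by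
  rcases h0.eq_or_lt with rfl | h0
  -- In `EReal`, `0 * x = 0` also for infinite `x`, so only `log tr σ` is left on the right.
  · simp only [EReal.coe_zero, zero_mul, zero_add, sub_zero, one_mul]
    refine le_of_tendsto ((continuous_neg.tendsto _).comp
      (tendsto_minimalDivergence_zero hρ hρ1 hσ)) ?_
    filter_upwards [Ioo_mem_nhdsGT (zero_lt_one (α := ℝ))] with a ha
    exact neg_minimalDivergence_le_log hρ hρ1 hσ hσ0 ha.1 ha.2
  rcases h1.eq_or_lt with rfl | h1
  · simp [minimalDivergence_one hρ hρ1 hσ hσ0]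
  · exact neg_minimalDivergence_le hρ hρ1 hσ hσ0 h0 h1

end Divergences

/-! ### Marginals and the operators `1 ⊗ σ_B` -/

section Bipartite

variable {A B : Type*} [Fintype A] [DecidableEq A] [Fintype B] [DecidableEq B]

omit [DecidableEq A] [DecidableEq B] in
theorem IsDensity.traceA {ρ : Matrix (A × B) (A × B) ℂ} (hρ : IsDensity ρ) :
    IsDensity (traceA ρ) := by
  constructor
  · have : QuantumRenyi.traceA ρ =
        ∑ i, ρ.submatrix (fun j : B => (i, j)) (fun j : B => (i, j)) := by
      ext j j'; simp [QuantumRenyi.traceA, Matrix.sum_apply]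
    rw [this]
    exact posSemidef_sum _ fun i _ => hρ.1.submatrix _
  · rw [← hρ.2]
    simp only [trace, diag_apply, QuantumRenyi.traceA, of_apply]
    rw [Fintype.sum_prod_type, sum_comm]

omit [DecidableEq B] in
theorem idTensor_posSemidef {σ : Matrix B B ℂ} (hσ : IsDensity σ) :
    (idTensor A σ).PosSemidef := PosSemidef.one.kronecker hσ.1

omit [DecidableEq B] in
theorem trace_idTensor {σ : Matrix B B ℂ} (hσ : IsDensity σ) :
    (idTensor A σ).trace.re = Fintype.card A := by
  simp [idTensor, trace_kronecker, hσ.2]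

end Bipartite

end QuantumRenyi

end

/-- The first conjunct says that the limits defining the orders `0` and `1` exist. -/
theorem corollary3 {A B : Type*} [Fintype A] [DecidableEq A] [Fintype B] [DecidableEq B]
    (ρ : Matrix (A × B) (A × B) ℂ) (hρ : QuantumRenyi.IsDensity ρ) :
    (∀ σ : Matrix B B ℂ, QuantumRenyi.IsDensity σ →
      Tendsto (fun a : ℝ => QuantumRenyi.petzDivergence a ρ (QuantumRenyi.idTensor A σ))
        (𝓝[>] 0) (𝓝 (QuantumRenyi.petzDivergence 0 ρ (QuantumRenyi.idTensor A σ))) ∧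
      Tendsto (fun a : ℝ => QuantumRenyi.petzDivergence a ρ (QuantumRenyi.idTensor A σ))
        (𝓝[≠] 1) (𝓝 (QuantumRenyi.petzDivergence 1 ρ (QuantumRenyi.idTensor A σ))) ∧
      Tendsto (fun a : ℝ => QuantumRenyi.minimalDivergence a ρ (QuantumRenyi.idTensor A σ))
        (𝓝[>] 0) (𝓝 (QuantumRenyi.minimalDivergence 0 ρ (QuantumRenyi.idTensor A σ))) ∧
      Tendsto (fun a : ℝ => QuantumRenyi.minimalDivergence a ρ (QuantumRenyi.idTensor A σ))
        (𝓝[≠] 1) (𝓝 (QuantumRenyi.minimalDivergence 1 ρ (QuantumRenyi.idTensor A σ)))) ∧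
    ∀ α : ℝ, 0 ≤ α → α ≤ 1 →
      (QuantumRenyi.petzDown α ρ ≤ QuantumRenyi.minimalDown α ρ ∧
        QuantumRenyi.minimalDown α ρ ≤ (α : EReal) * QuantumRenyi.petzDown α ρ +
          (((1 - α) * Real.log (Fintype.card A) : ℝ) : EReal)) ∧
      (QuantumRenyi.petzUp α ρ ≤ QuantumRenyi.minimalUp α ρ ∧
        QuantumRenyi.minimalUp α ρ ≤ (α : EReal) * QuantumRenyi.petzUp α ρ +
          (((1 - α) * Real.log (Fintype.card A) : ℝ) : EReal)) := by
  have hρ0 := hρ.1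
  have hρ1 : ρ.trace.re = 1 := by rw [hρ.2, Complex.one_re]
  -- An empty `A` would make the trace of `ρ` equal to `0`.
  have hcard : 0 < Fintype.card A := by
    rw [Fintype.card_pos_iff]
    by_contra h
    rw [not_nonempty_iff] at h
    have := hρ.2
    simp [Matrix.trace] at this
  have hpos : ∀ σ : Matrix B B ℂ, QuantumRenyi.IsDensity σ →
      0 < (QuantumRenyi.idTensor A σ).trace.re := fun σ hσ => by
    rw [QuantumRenyi.trace_idTensor hσ]; exact_mod_cast hcard
  have h1 : ∀ σ : Matrix B B ℂ, QuantumRenyi.IsDensity σ → ∀ α : ℝ, 0 ≤ α → α ≤ 1 →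
      -QuantumRenyi.petzDivergence α ρ (QuantumRenyi.idTensor A σ) ≤
        -QuantumRenyi.minimalDivergence α ρ (QuantumRenyi.idTensor A σ) :=
    fun σ hσ α h0 h1 => QuantumRenyi.neg_petzDivergence_le_neg_minimalDivergence hρ0 hρ1
      (QuantumRenyi.idTensor_posSemidef hσ) (hpos σ hσ) h0 h1
  have h2 : ∀ σ : Matrix B B ℂ, QuantumRenyi.IsDensity σ → ∀ α : ℝ, 0 ≤ α → α ≤ 1 →
      -QuantumRenyi.minimalDivergence α ρ (QuantumRenyi.idTensor A σ) ≤
        (α : EReal) * -QuantumRenyi.petzDivergence α ρ (QuantumRenyi.idTensor A σ) +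
          (((1 - α) * Real.log (Fintype.card A) : ℝ) : EReal) := fun σ hσ α h0 h1 => by
    have := QuantumRenyi.neg_minimalDivergence_le_of_le_one hρ0 hρ1
      (QuantumRenyi.idTensor_posSemidef hσ) (hpos σ hσ) h0 h1
    rwa [QuantumRenyi.trace_idTensor hσ] at this
  refine ⟨fun σ hσ => ?_, fun α h0 hα1 => ⟨⟨h1 _ hρ.traceA α h0 hα1, h2 _ hρ.traceA α h0 hα1⟩,
    ?_, ?_⟩⟩
  · have hσ0 := QuantumRenyi.idTensor_posSemidef (A := A) hσ
    refine ⟨QuantumRenyi.tendsto_petzDivergence_zero hρ0 hρ1 hσ0,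
      QuantumRenyi.tendsto_petzDivergence_one hρ0 hρ1 hσ0,
      QuantumRenyi.tendsto_minimalDivergence_zero hρ0 hρ1 hσ0, ?_⟩
    rw [QuantumRenyi.minimalDivergence_one hρ0 hρ1 hσ0 (hpos σ hσ)]
    exact QuantumRenyi.tendsto_minimalDivergence_petzDivergence_one hρ0 hρ1 hσ0 (hpos σ hσ)
  · exact iSup_mono fun σ => h1 σ.1 σ.2 α h0 hα1
  -- Since `α ≥ 0`, the Petz term at this `σ` may be replaced by its supremum; no optimizer is
  -- needed.
  · refine iSup_le fun σ => (h2 σ.1 σ.2 α h0 hα1).trans ?_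
    refine add_le_add (mul_le_mul_of_nonneg_left ?_ (EReal.coe_nonneg.2 h0)) le_rfl
    exact le_iSup (fun σ : {σ : Matrix B B ℂ // QuantumRenyi.IsDensity σ} =>
      -QuantumRenyi.petzDivergence α ρ (QuantumRenyi.idTensor A σ.1)) σ
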